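/- **Setting.** All posets are finite. The width of a poset is the largest size of an antichain in it. An *on-line chain partitioning algorithm* receives the points $v_1,v_2,\dots,v_n$ of a poset one by one in some presentation order and irrevocably assigns to each $v_i$ a colour (the index of a chain) that is determined solely by the subposet induced by $v_1,\dots,v_i$ together with their presentation order; points of the same colour must be pairwise comparable. For an algorithm $\mathcal A$ and a poset $P$ let $\chi_{\mathcal A}(P)$ be the maximum, over all presentation orders of $P$, of the number of colours that $\mathcal A$ uses. For a class $\mathcal P$ of posets let $\mathrm{val}(\mathcal P)=\min_{\mathcal A}\sup_{P\in\mathcal P}\chi_{\mathcal A}(P)\in\mathbb N\cup\{\infty\}$. Let $\mathcal P_w$ be the class of posets of width $w$. For sets $A,B$ of points write $A\sqsubseteq B$ if every $a\in A$ satisfies $a\le b$ for some $b\in B$, and $A\sqsubset B$ if moreover $A\ne B$. A *maximum antichain* is an antichain whose size is the width. A *Dilworth edge* of a poset $Q$ is a pair of points that lie in a common chain of some partition of $Q$ into $\mathrm{width}(Q)$ chains. A *core* is a poset that is the union of two disjoint maximum antichains $A\sqsubset B$ with $|A|=|B|$ such that every pair $x\le y$ with $x\in A$, $y\in B$ is a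 Dilworth edge. A *regular poset of width $w$* is a tuple $(P,A_1,\dots,A_n)$, where $P$ is a poset of width $w$ and $A_1,\dots,A_n$ are maximum antichains of $P$, such that: 1. $P=A_1\cup\dots\cup A_n$; 2. the $A_i$ are pairwise disjoint; 3. the set $\{A_1,\dots,A_n\}$ is linearly ordered by $\sqsubseteq$; 4. whenever $A_{s(i)}$ exists, $P[A_i\cup A_{s(i)}]$ is a core (with lower antichain $A_i$), and whenever $A_{p(i)}$ exists, $P[A_{p(i)}\cup A_i]$ is a core (with lower antichain $A_{p(i)}$), where $A_{s(i)}$ is the $\sqsubseteq$-least $A_k$ with $k<i$ and $A_i\sqsubset A_k$, and $A_{p(i)}$ is the $\sqsubseteq$-greatest $A_k$ with $k<i$ and $A_k\sqsubset A_i$; 5. if $x<y$, $x\in A_i$, $y\in A_j$, then: if $i>j$, the antichain $A_{s(i)}$ exists and contains some $z$ with $x<z\le y$; otherwise $A_{p(j)}$ exists and contains some $z$ with $x\le z<y$. Let $\mathcal R_w$ be the class of regular posets of width $w$. An on-line algorithm for $\mathcal R_w$ receives in round $i$ all points of $A_i$ at once (the points of each antichain carry arbitrary distinct names $1,\dots,w$)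 and irrevocably colours them, solely on the basis of $P[A_1\cup\dots\cup A_i]$ presented in this way; on every member of $\mathcal R_w$, points of the same colour must be pairwise comparable. Let $\mathrm{val}(\mathcal R_w)\in\mathbb N\cup\{\infty\}$ be the minimum, over all such algorithms, of the largest number of colours used on a member of $\mathcal R_w$. **Lemma.** For every integer $w\ge 0$, $$\mathrm{val}(\mathcal P_w)\le \mathrm{val}(\mathcal R_1)+\dots+\mathrm{val}(\mathcal R_w).$$ -/

import Mathlib

namespace OnlineChain

section Posets

variable {V : Type} [PartialOrder V]

open Classical in
/-- The width of the subposet induced by the finite set `S`: the largest size of an antichain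
contained in `S`. -/
noncomputable def width (S : Finset V) : ℕ :=
  (S.powerset.filter fun T : Finset V => IsAntichain (· ≤ ·) (T : Set V)).sup Finset.card

/-- `A` is a maximum antichain (an antichain of largest possible size) of the subposet induced
by `S`. -/
structure IsMaxAntichain (S A : Finset V) : Prop where
  subset : A ⊆ S
  antichain : IsAntichain (· ≤ ·) (A : Set V)
  card_eq : A.card = width S

/-- `A ⊑ B`: the set `A` is contained in the closed downset of `B`. -/
def Below (A B : Finset V) : Prop :=
  ∀ a ∈ A, ∃ b ∈ B, a ≤ b

/-- `A ⊏ B`. -/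
def StrictBelow (A B : Finset V) : Prop :=
  Below A B ∧ A ≠ B

/-- `c` describes a Dilworth partition of the subposet induced by `S`, that is, a partition of `S`
into `width S` chains; `c x` is the index of the chain that contains `x`. (As an antichain of size
`width S` meets `width S` different chains, no chain is empty.) -/
structure IsDilworthPartition (S : Finset V) (c : V → ℕ) : Prop where
  lt_width : ∀ x ∈ S, c x < width S
  chain : ∀ x ∈ S, ∀ y ∈ S, c x = c y → x ≤ y ∨ y ≤ x

/-- `u` and `v` lie in the same chain of some Dilworth partition of the subposet induced
by `S`. -/
def IsDilworthEdge (S : Finset V) (u v : V) : Prop :=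
  u ∈ S ∧ v ∈ S ∧ ∃ c : V → ℕ, IsDilworthPartition S c ∧ c u = c v

open Classical in
/-- The subposet induced by `A ∪ B` is a bipartite poset `(A, B, ≤)`: it is the disjoint union of
its maximum antichains `A` and `B`, and `A ⊏ B`. -/
structure IsBipartite (A B : Finset V) : Prop where
  disjoint : Disjoint A B
  maximum_left : IsMaxAntichain (A ∪ B) A
  maximum_right : IsMaxAntichain (A ∪ B) B
  below : StrictBelow A B

open Classical in
/-- The bipartite poset `(A, B, ≤)` is a core: `A` and `B` have the same size, and every comparable
pair `x ≤ y` with `x ∈ A` and `y ∈ B` is a Dilworth edge. -/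
structure IsCore (A B : Finset V) : Prop extends IsBipartite A B where
  card_eq : A.card = B.card
  dilworth : ∀ x ∈ A, ∀ y ∈ B, x ≤ y → IsDilworthEdge (A ∪ B) x y

/-- `s = s(i)`: among the sets presented before `A i`, the set `A s` is the `⊑`-least one that is
strictly above `A i`. -/
structure IsNextAbove {n : ℕ} (A : Fin n → Finset V) (i s : Fin n) : Prop where
  earlier : s < i
  above : StrictBelow (A i) (A s)
  least : ∀ k, k < i → StrictBelow (A i) (A k) → Below (A s) (A k)

/-- `p = p(i)`: among the sets presented before `A i`, the set `A p` is the `⊑`-greatest one that is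
strictly below `A i`. -/
structure IsNextBelow {n : ℕ} (A : Fin n → Finset V) (i p : Fin n) : Prop where
  earlier : p < i
  below : StrictBelow (A p) (A i)
  greatest : ∀ k, k < i → StrictBelow (A k) (A i) → Below (A k) (A p)

/-- The poset `V`, presented as the sequence `A 0, …, A (n - 1)` of maximum antichains, is a regular
poset of width `w`. -/
structure IsRegular [Fintype V] (w : ℕ) {n : ℕ} (A : Fin n → Finset V) : Prop where
  width_eq : width (Finset.univ : Finset V) = w
  maximum : ∀ i, IsMaxAntichain Finset.univ (A i)
  cover : ∀ x : V, ∃ i, x ∈ A i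
  disjoint : ∀ i j, i ≠ j → Disjoint (A i) (A j)
  linear : ∀ i j, Below (A i) (A j) ∨ Below (A j) (A i)
  core_above : ∀ i s, IsNextAbove A i s → IsCore (A i) (A s)
  core_below : ∀ i p, IsNextBelow A i p → IsCore (A p) (A i)
  trans_above : ∀ i j, j < i → ∀ x ∈ A i, ∀ y ∈ A j, x < y →
    ∃ s, IsNextAbove A i s ∧ ∃ z ∈ A s, x < z ∧ z ≤ y
  trans_below : ∀ i j, i ≤ j → ∀ x ∈ A i, ∀ y ∈ A j, x < y →
    ∃ p, IsNextBelow A j p ∧ ∃ z ∈ A p, x ≤ z ∧ z < y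

end Posets

section Posetwise

/-- The colours (indices of chains) given to the points `v 0, v 1, …` of a poset, presented in this
order, when the colour of the `i`-th point is computed by `f` from the order relation among the
points presented up to this moment. -/
def onlineColoring (f : ∀ i : ℕ, (Fin (i + 1) → Fin (i + 1) → Prop) → ℕ)
    {V : Type} [PartialOrder V] {n : ℕ} (v : Fin n → V) (i : Fin n) : ℕ :=
  f i fun a b => v (Fin.castLE i.isLt a) ≤ v (Fin.castLE i.isLt b)

/-- An on-line chain partitioning algorithm: a rule that gives every newly presented point a colour
depending only on the subposet induced by the points presented so far (with their presentation
order), such that on every finite poset, in every presentation order, points of the same colour are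
comparable. A presentation order of a poset `P` on `n` points is a bijection `Fin n ≃ P`. -/
structure Algorithm where
  color : ∀ i : ℕ, (Fin (i + 1) → Fin (i + 1) → Prop) → ℕ
  chain : ∀ (P : FinPartOrd.{0}) (n : ℕ) (v : Fin n ≃ P) (i j : Fin n),
    onlineColoring color v i = onlineColoring color v j → v i ≤ v j ∨ v j ≤ v i

/-- The number of nonempty chains that the algorithm uses on the poset `P` presented by `v`. -/
noncomputable def Algorithm.chiOn (𝒜 : Algorithm) {P : FinPartOrd.{0}} {n : ℕ}
    (v : Fin n ≃ P) : ℕ∞ :=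
  (Set.range (onlineColoring 𝒜.color v)).encard

/-- The largest number of chains that the algorithm uses on `P`, over all presentation orders. -/
noncomputable def Algorithm.chi (𝒜 : Algorithm) (P : FinPartOrd.{0}) : ℕ∞ :=
  ⨆ (n : ℕ) (v : Fin n ≃ P), 𝒜.chiOn v

/-- The number of chains needed to partition on-line the posets of the class `C`. -/
noncomputable def val (C : Set FinPartOrd.{0}) : ℕ∞ :=
  ⨅ 𝒜 : Algorithm, ⨆ P ∈ C, 𝒜.chi P

/-- The class of finite posets of width `w`. -/
def posetsOfWidth (w : ℕ) : Set FinPartOrd.{0} :=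
  {P | width (Finset.univ : Finset P) = w}

end Posetwise

section Antichainwise

/-- A regular poset of width `w`. -/
structure RegularPoset (w : ℕ) where
  poset : FinPartOrd.{0}
  rounds : ℕ
  antichain : Fin rounds → Finset poset
  regular : IsRegular w antichain

/-- A naming of the points of a regular poset: the `w` points of the antichain presented in round
`i` are named `(i, 0), …, (i, w - 1)`, in an arbitrary way. -/
structure RegularPoset.Naming {w : ℕ} (R : RegularPoset w) where
  point : Fin R.rounds × Fin w ≃ R.poset
  mem : ∀ i k, point (i, k) ∈ R.antichain i

/-- The colours given to the points of a poset presented by antichains of size `w` when the colours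
of the `w` points of round `i` are computed by `f` from the order relation among all points
presented up to and including round `i`. -/
def roundColoring {w : ℕ}
    (f : ∀ i : ℕ, (Fin (i + 1) × Fin w → Fin (i + 1) × Fin w → Prop) → Fin w → ℕ)
    {V : Type} [PartialOrder V] {n : ℕ} (v : Fin n × Fin w → V) (x : Fin n × Fin w) : ℕ :=
  f x.1 (fun a b => v (Fin.castLE x.1.isLt a.1, a.2) ≤ v (Fin.castLE x.1.isLt b.1, b.2)) x.2

/-- An on-line chain partitioning algorithm for regular posets of width `w`: in every round, a whole
antichain is presented, and its points are given colours that depend only on the subposet induced by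
the antichains presented so far; on every regular poset of width `w`, with every naming of its
points, points of the same colour are comparable. -/
structure RegularAlgorithm (w : ℕ) where
  color : ∀ i : ℕ, (Fin (i + 1) × Fin w → Fin (i + 1) × Fin w → Prop) → Fin w → ℕ
  chain : ∀ (R : RegularPoset w) (v : R.Naming) (x y : Fin R.rounds × Fin w),
    roundColoring color v.point x = roundColoring color v.point y →
      v.point x ≤ v.point y ∨ v.point y ≤ v.point x

/-- The largest number of chains that the algorithm uses on the regular poset `R`. -/
noncomputable def RegularAlgorithm.chi {w : ℕ} (𝒜 : RegularAlgorithm w)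
    (R : RegularPoset w) : ℕ∞ :=
  ⨆ v : R.Naming, (Set.range (roundColoring 𝒜.color v.point)).encard

/-- The number of chains needed to partition on-line the regular posets of width `w`. -/
noncomputable def valRegular (w : ℕ) : ℕ∞ :=
  ⨅ 𝒜 : RegularAlgorithm w, ⨆ R : RegularPoset w, 𝒜.chi R

end Antichainwise

end OnlineChain

/-!
The points of a presented poset are split on-line into levels `1, …, w`, such that the points of
level at most `k` form a set of width at most `k` (`widthLE_level_le`) and every point of level `k`
lies in an antichain of `k` points of level at most `k`, none of them presented after it
(`exists_isKAntichain`). The points of level `k` are coloured by an optimal algorithm for regular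
posets of width `k`, with a separate palette for every level.

To this end, a maximum antichain through each point `n` of level `k` is chosen among the points of
level at most `k` presented so far. Maximum antichains form a lattice. Joining an antichain through
`n` with the earlier chosen antichains having a point below `n`, and then meeting it with those
having a point above `n`, makes the chosen antichains a chain with respect to `⊑`
(`exists_comparable_to_all`). They become disjoint when replaced by copies, and by Hall's theorem
any two of them are joined by a perfect matching of comparable pairs (`RelBelow.exists_perm`).

The copies carry the order `RegLE`, a suborder of the original one: a new antichain is joined to its
two neighbours among the earlier ones by the edges that lie in perfect matchings, and to all others
through these neighbours. The order between earlier antichains needs no change, since a composition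
of two matching edges is again a matching edge (`IsLadder.regLE_trans`). Thus the copies form a
regular poset (`IsLadder.isRegular`) that is presented on-line, and the colour of `n` is that of its
copy in the antichain chosen for it. Points whose copies are comparable are comparable.
-/

namespace OnlineChain

/-! ### The order of the regular poset of a ladder of rows -/

section Ladder

variable {k : ℕ} {q q' : ℕ → Fin k → ℕ → Fin k → Prop} {m : ℕ}

/-- A preorder on the points `(i, t)`, where `t` numbers the `k` points of the antichain (row)
presented in round `i`, is encoded as a curried relation `q i t j u`. Row `i` lies below row `j` if
some permutation matches every point of row `i` with a point of row `j` above it. For maximum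
antichains this is the relation `⊑`. -/
def RowLE (q : ℕ → Fin k → ℕ → Fin k → Prop) (i j : ℕ) : Prop :=
  ∃ σ : Equiv.Perm (Fin k), ∀ t, q i t j (σ t)

/-- The pair `(i, t)`, `(j, u)` belongs to a perfect matching of comparable pairs between the rows
`i` and `j`. These are the Dilworth edges between two rows. -/
def MatchEdge (q : ℕ → Fin k → ℕ → Fin k → Prop) (i j : ℕ) (t u : Fin k) : Prop :=
  ∃ σ : Equiv.Perm (Fin k), (∀ s, q i s j (σ s)) ∧ σ t = u

/-- `s` is the least row above row `i` among the rows presented before it. -/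
structure NextUp (q : ℕ → Fin k → ℕ → Fin k → Prop) (i s : ℕ) : Prop where
  lt : s < i
  rowLE : RowLE q i s
  least : ∀ l < i, RowLE q i l → RowLE q s l

/-- `p` is the greatest row below row `i` among the rows presented before it. -/
structure NextDown (q : ℕ → Fin k → ℕ → Fin k → Prop) (i p : ℕ) : Prop where
  lt : p < i
  rowLE : RowLE q p i
  greatest : ∀ l < i, RowLE q l i → RowLE q l p

/-- The order of the regular poset built from the rows: when a row is presented, only matching edges
to its two neighbours among the earlier rows are kept, and everything else is obtained by composing
them with the order between earlier rows. -/
inductive RegLE (q : ℕ → Fin k → ℕ → Fin k → Prop) : ℕ → Fin k → ℕ → Fin k → Prop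
  | refl (i : ℕ) (t : Fin k) : RegLE q i t i t
  | up {i s j : ℕ} {t v u : Fin k} (hij : j < i) (hs : NextUp q i s) (he : MatchEdge q i s t v)
      (h : RegLE q s v j u) : RegLE q i t j u
  | down {i p j : ℕ} {t v u : Fin k} (hij : i < j) (hp : NextDown q j p) (h : RegLE q i t p v)
      (he : MatchEdge q p j v u) : RegLE q i t j u

/-- The rows `0, …, m - 1` form a chain in the order `RowLE` of a preorder `q`. -/
structure IsLadder (q : ℕ → Fin k → ℕ → Fin k → Prop) (m : ℕ) : Prop where
  refl : ∀ i t, q i t i t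
  trans : ∀ i t j u l v, q i t j u → q j u l v → q i t l v
  total : ∀ i < m, ∀ j < m, RowLE q i j ∨ RowLE q j i
  antisymm : ∀ i < m, ∀ j < m, RowLE q i j → RowLE q j i → i = j

theorem MatchEdge.rowLE {i j : ℕ} {t u : Fin k} (h : MatchEdge q i j t u) : RowLE q i j :=
  h.imp fun _ hσ => hσ.1

theorem RegLE.eq_of_row_eq {i : ℕ} {t u : Fin k} (h : RegLE q i t i u) : t = u := by
  cases h with
  | refl => rfl
  | up hij => exact absurd hij (lt_irrefl i)
  | down hij => exact absurd hij (lt_irrefl i)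

namespace IsLadder

variable (h : IsLadder q m)
include h

theorem rowLE_refl (i : ℕ) : RowLE q i i := ⟨1, fun t => h.refl i t⟩

theorem rowLE_trans {i j l : ℕ} : RowLE q i j → RowLE q j l → RowLE q i l := by
  rintro ⟨σ, hσ⟩ ⟨τ, hτ⟩
  exact ⟨σ.trans τ, fun t => h.trans _ _ _ _ _ _ (hσ t) (hτ (σ t))⟩

theorem matchEdge_trans {i j l : ℕ} {t u v : Fin k} :
    MatchEdge q i j t u → MatchEdge q j l u v → MatchEdge q i l t v := by
  rintro ⟨σ, hσ, rfl⟩ ⟨τ, hτ, rfl⟩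
  exact ⟨σ.trans τ, fun t => h.trans _ _ _ _ _ _ (hσ t) (hτ (σ t)), rfl⟩

theorem rowLE_of_regLE {i j : ℕ} {t u : Fin k} (hr : RegLE q i t j u) : RowLE q i j := by
  induction hr with
  | refl i t => exact h.rowLE_refl i
  | up _ hs _ _ ih => exact h.rowLE_trans hs.rowLE ih
  | down _ hp _ _ ih => exact h.rowLE_trans ih hp.rowLE

theorem of_regLE {i j : ℕ} {t u : Fin k} (hr : RegLE q i t j u) : q i t j u := by
  induction hr with
  | refl i t => exact h.refl i t
  | up _ _ he _ ih => obtain ⟨σ, hσ, rfl⟩ := he; exact h.trans _ _ _ _ _ _ (hσ _) ih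
  | down _ _ _ he ih => obtain ⟨σ, hσ, rfl⟩ := he; exact h.trans _ _ _ _ _ _ ih (hσ _)

theorem regLE_antisymm {i j : ℕ} {t u : Fin k} (hi : i < m) (hj : j < m) (h₁ : RegLE q i t j u)
    (h₂ : RegLE q j u i t) : i = j ∧ t = u := by
  obtain rfl := h.antisymm i hi j hj (h.rowLE_of_regLE h₁) (h.rowLE_of_regLE h₂)
  exact ⟨rfl, h₁.eq_of_row_eq⟩

theorem nextUp_unique {i s s' : ℕ} (hi : i < m) (hs : NextUp q i s) (hs' : NextUp q i s') :
    s = s' :=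
  h.antisymm _ (hs.lt.trans hi) _ (hs'.lt.trans hi) (hs.least _ hs'.lt hs'.rowLE)
    (hs'.least _ hs.lt hs.rowLE)

theorem nextDown_unique {i p p' : ℕ} (hi : i < m) (hp : NextDown q i p) (hp' : NextDown q i p') :
    p = p' :=
  h.antisymm _ (hp.lt.trans hi) _ (hp'.lt.trans hi) (hp'.greatest _ hp.lt hp.rowLE)
    (hp.greatest _ hp'.lt hp'.rowLE)

theorem regLE_iff_of_nextUp {i s : ℕ} (hi : i < m) (hs : NextUp q i s) {t u : Fin k} :
    RegLE q i t s u ↔ MatchEdge q i s t u := by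
  refine ⟨fun hr => ?_, fun he => .up hs.lt hs he (.refl _ _)⟩
  cases hr with
  | refl => exact absurd hs.lt (lt_irrefl _)
  | up _ hs' he hr =>
    obtain rfl := h.nextUp_unique hi hs hs'
    rwa [← hr.eq_of_row_eq]
  | down hij => exact absurd hs.lt hij.not_gt

theorem regLE_iff_of_nextDown {i p : ℕ} (hi : i < m) (hp : NextDown q i p) {t u : Fin k} :
    RegLE q p t i u ↔ MatchEdge q p i t u := by
  refine ⟨fun hr => ?_, fun he => .down hp.lt hp (.refl _ _) he⟩
  cases hr with
  | refl => exact absurd hp.lt (lt_irrefl _)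
  | up hij => exact absurd hp.lt hij.not_gt
  | down _ hp' hr he =>
    obtain rfl := h.nextDown_unique hi hp hp'
    rwa [hr.eq_of_row_eq]

/-- The rows around a newly inserted row `j` were neighbours when the later of the two was inserted,
so the matching edges between them belong to the order. -/
theorem regLE_of_neighbours {j p s : ℕ} (hj : j < m) (hp : NextDown q j p) (hs : NextUp q j s)
    {t u : Fin k} (he : MatchEdge q p s t u) : RegLE q p t s u := by
  have hpm := hp.lt.trans hj
  have hsm := hs.lt.trans hj
  rcases lt_trichotomy p s with hlt | rfl | hlt
  · refine .down hlt ⟨hlt, he.rowLE, fun l hl hls => ?_⟩ (.refl _ _) he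
    rcases h.total l (hl.trans hsm) j hj with hlj | hjl
    · exact hp.greatest l (hl.trans hs.lt) hlj
    · exact absurd (h.antisymm _ (hl.trans hsm) _ hsm hls (hs.least l (hl.trans hs.lt) hjl)) hl.ne
  · exact absurd (h.antisymm _ hpm _ hj hp.rowLE hs.rowLE) hp.lt.ne
  · refine .up hlt ⟨hlt, he.rowLE, fun l hl hpl => ?_⟩ he (.refl _ _)
    rcases h.total j hj l (hl.trans hpm) with hjl | hlj
    · exact hs.least l (hl.trans hp.lt) hjl
    · exact absurd (h.antisymm _ (hl.trans hpm) _ hpm (hp.greatest l (hl.trans hp.lt) hlj) hpl)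
        hl.ne

/-- The crucial case is a middle row `j` presented last: both comparabilities then pass
through a neighbour of row `j`, and the two matching edges at row `j` compose to one between the two
neighbours. -/
theorem regLE_trans {i j l : ℕ} {t u v : Fin k} (hi : i < m) (hj : j < m) (hl : l < m)
    (h₁ : RegLE q i t j u) (h₂ : RegLE q j u l v) : RegLE q i t l v := by
  obtain ⟨N, hNm, hiN, hjN, hlN⟩ : ∃ N ≤ m, i < N ∧ j < N ∧ l < N := ⟨m, le_rfl, hi, hj, hl⟩
  clear hi hj hl
  -- Induction on a strict bound of the three row numbers; the largest one is eliminated.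
  induction N generalizing i j l t u v with
  | zero => omega
  | succ N ih =>
    have hlink : l = i → i = j := by
      rintro rfl
      exact h.antisymm _ (by omega) _ (by omega) (h.rowLE_of_regLE h₁) (h.rowLE_of_regLE h₂)
    by_cases hij : i = j
    · subst hij; rwa [h₁.eq_of_row_eq]
    by_cases hjl : j = l
    · subst hjl; rwa [← h₂.eq_of_row_eq]
    have hli : l ≠ i := fun e => hij (hlink e)
    by_cases hi : j < i ∧ l < i
    · cases h₁ with
      | refl => exact absurd rfl hij
      | down => omega
      | up _ hs he hr =>
        exact .up hi.2 hs he (ih hr h₂ (by omega) (by have := hs.lt; omega) (by omega) (by omega))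
    by_cases hl : i < l ∧ j < l
    · cases h₂ with
      | refl => exact absurd rfl hjl
      | up => omega
      | down _ hp hr he =>
        exact .down hl.1 hp (ih h₁ hr (by omega) (by omega) (by omega) (by have := hp.lt; omega)) he
    have hj : i < j ∧ l < j := by omega
    cases h₁ with
    | refl => omega
    | up => omega
    | down _ hp hr₁ he₁ =>
      cases h₂ with
      | refl => omega
      | down => omega
      | up _ hs he₂ hr₂ =>
        have := hp.lt
        have := hs.lt
        have hps := h.regLE_of_neighbours (by omega) hp hs (h.matchEdge_trans he₁ he₂)
        exact ih (ih hr₁ hps (by omega) (by omega) (by omega) (by omega)) hr₂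
          (by omega) (by omega) (by omega) (by omega)

theorem exists_greatest {I : Finset ℕ} (hI : I.Nonempty) (hm : ∀ i ∈ I, i < m) :
    ∃ p ∈ I, ∀ i ∈ I, RowLE q i p := by
  induction hI using Finset.Nonempty.cons_induction with
  | singleton a => exact ⟨a, by simp, by simpa using h.rowLE_refl a⟩
  | cons a s ha hs ih =>
    simp only [Finset.mem_cons, forall_eq_or_imp] at hm
    obtain ⟨p, hp, hmax⟩ := ih hm.2
    simp only [Finset.mem_cons, exists_eq_or_imp, forall_eq_or_imp]
    rcases h.total a hm.1 p (hm.2 p hp) with hap | hpa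
    · exact .inr ⟨p, hp, hap, hmax⟩
    · exact .inl ⟨h.rowLE_refl a, fun i hi => h.rowLE_trans (hmax i hi) hpa⟩

theorem exists_least {I : Finset ℕ} (hI : I.Nonempty) (hm : ∀ i ∈ I, i < m) :
    ∃ s ∈ I, ∀ i ∈ I, RowLE q s i := by
  induction hI using Finset.Nonempty.cons_induction with
  | singleton a => exact ⟨a, by simp, by simpa using h.rowLE_refl a⟩
  | cons a s ha hs ih =>
    simp only [Finset.mem_cons, forall_eq_or_imp] at hm
    obtain ⟨p, hp, hmin⟩ := ih hm.2
    simp only [Finset.mem_cons, exists_eq_or_imp, forall_eq_or_imp]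
    rcases h.total a hm.1 p (hm.2 p hp) with hap | hpa
    · exact .inl ⟨h.rowLE_refl a, fun i hi => h.rowLE_trans hap (hmin i hi)⟩
    · exact .inr ⟨p, hp, hpa, hmin⟩

theorem exists_nextUp {i j : ℕ} (hi : i < m) (hij : j < i) (hle : RowLE q i j) :
    ∃ s, NextUp q i s := by
  classical
  obtain ⟨s, hs, hmin⟩ := h.exists_least (I := (Finset.range i).filter (RowLE q i))
    ⟨j, by simp [hij, hle]⟩ (fun l hl => by simp at hl; omega)
  simp only [Finset.mem_filter, Finset.mem_range] at hs hmin
  exact ⟨s, hs.1, hs.2, fun l hl hil => hmin l ⟨hl, hil⟩⟩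

theorem exists_nextDown {i j : ℕ} (hi : i < m) (hij : j < i) (hle : RowLE q j i) :
    ∃ p, NextDown q i p := by
  classical
  obtain ⟨p, hp, hmax⟩ := h.exists_greatest (I := (Finset.range i).filter (RowLE q · i))
    ⟨j, by simp [hij, hle]⟩ (fun l hl => by simp at hl; omega)
  simp only [Finset.mem_filter, Finset.mem_range] at hp hmax
  exact ⟨p, hp.1, hp.2, fun l hl hil => hmax l ⟨hl, hil⟩⟩

/-- The order of the regular poset still contains a perfect matching between any two rows. -/
theorem exists_regLE_perm {i j : ℕ} (hi : i < m) (hj : j < m) (hij : RowLE q i j) :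
    ∃ σ : Equiv.Perm (Fin k), ∀ t, RegLE q i t j (σ t) := by
  obtain ⟨N, hNm, hiN, hjN⟩ : ∃ N ≤ m, i < N ∧ j < N := ⟨m, le_rfl, hi, hj⟩
  clear hi hj
  induction N generalizing i j with
  | zero => omega
  | succ N ih =>
    rcases lt_trichotomy i j with hlt | rfl | hlt
    · obtain ⟨p, hp⟩ := h.exists_nextDown (by omega) hlt hij
      have := hp.lt
      obtain ⟨σ, hσ⟩ := ih (hp.greatest _ hlt hij) (by omega) (by omega) (by omega)
      obtain ⟨τ, hτ⟩ := hp.rowLE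
      exact ⟨σ.trans τ, fun t => .down hlt hp (hσ t) ⟨τ, hτ, rfl⟩⟩
    · exact ⟨1, fun t => .refl _ _⟩
    · obtain ⟨s, hs⟩ := h.exists_nextUp (by omega) hlt hij
      have := hs.lt
      obtain ⟨σ, hσ⟩ := ih (hs.least _ hlt hij) (by omega) (by omega) (by omega)
      obtain ⟨τ, hτ⟩ := hs.rowLE
      exact ⟨τ.trans σ, fun t => .up hlt hs ⟨τ, hτ, rfl⟩ (hσ _)⟩

/-- Perfect matchings between consecutive rows compose to a partition into `k` chains. -/
theorem exists_chain_coloring (I : Finset ℕ) (hm : ∀ i ∈ I, i < m) :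
    ∃ c : ℕ → Equiv.Perm (Fin k), ∀ i ∈ I, ∀ j ∈ I, ∀ t u, c i t = c j u →
      RegLE q i t j u ∨ RegLE q j u i t := by
  induction I using Finset.strongInduction with
  | H I ih =>
    rcases I.eq_empty_or_nonempty with rfl | hI
    · exact ⟨1, by simp⟩
    obtain ⟨j, hj, hmax⟩ := h.exists_greatest hI hm
    obtain ⟨c, hc⟩ := ih (I.erase j) (Finset.erase_ssubset hj)
      (fun i hi => hm i (Finset.mem_of_mem_erase hi))
    -- The greatest row `j` is attached to the greatest remaining row by a perfect matching.
    obtain ⟨τ, hτ⟩ : ∃ τ : Equiv.Perm (Fin k), ∀ i ∈ I.erase j, ∀ t u, c i t = τ u →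
        RegLE q i t j u := by
      rcases (I.erase j).eq_empty_or_nonempty with he | he
      · exact ⟨1, by simp [he]⟩
      have hm' : ∀ i ∈ I.erase j, i < m := fun i hi => hm i (Finset.mem_of_mem_erase hi)
      obtain ⟨p, hp, hpmax⟩ := h.exists_greatest he hm'
      obtain ⟨σ, hσ⟩ := h.exists_regLE_perm (hm' p hp) (hm j hj)
        (hmax p (Finset.mem_of_mem_erase hp))
      refine ⟨σ.symm.trans (c p), fun i hi t u hiu => ?_⟩
      have hpj : RegLE q p (σ.symm u) j u := by simpa using hσ (σ.symm u)
      refine h.regLE_trans (hm' i hi) (hm' p hp) (hm j hj) ?_ hpj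
      rcases hc i hi p hp _ _ hiu with hle | hge
      · exact hle
      · obtain rfl := h.antisymm _ (hm' i hi) _ (hm' p hp) (hpmax i hi) (h.rowLE_of_regLE hge)
        exact hge.eq_of_row_eq ▸ .refl _ _
    refine ⟨Function.update c j τ, fun i hi l hl t u heq => ?_⟩
    by_cases hij : i = j <;> by_cases hlj : l = j
    · subst hij; subst hlj
      simp only [Function.update_self, EmbeddingLike.apply_eq_iff_eq] at heq
      exact .inl (heq ▸ .refl _ _)
    · subst hij
      rw [Function.update_self, Function.update_of_ne hlj] at heq
      exact .inr (hτ l (Finset.mem_erase.2 ⟨hlj, hl⟩) _ _ heq.symm)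
    · subst hlj
      rw [Function.update_self, Function.update_of_ne hij] at heq
      exact .inl (hτ i (Finset.mem_erase.2 ⟨hij, hi⟩) _ _ heq)
    · rw [Function.update_of_ne hij, Function.update_of_ne hlj] at heq
      exact hc i (Finset.mem_erase.2 ⟨hij, hi⟩) l (Finset.mem_erase.2 ⟨hlj, hl⟩) _ _ heq

end IsLadder

/-- The order of the regular poset between two rows depends only on the rows presented so far. -/
theorem RegLE.mono_of_agree {n : ℕ} (hq : ∀ i < n, ∀ j < n, ∀ t u, q i t j u ↔ q' i t j u)
    {i j : ℕ} {t u : Fin k} (hi : i < n) (hj : j < n) (hr : RegLE q i t j u) :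
    RegLE q' i t j u := by
  have hrow : ∀ i < n, ∀ j < n, (RowLE q i j ↔ RowLE q' i j) := fun i hi j hj => by
    simp only [RowLE, hq i hi j hj]
  have hedge : ∀ i < n, ∀ j < n, ∀ t u, MatchEdge q i j t u → MatchEdge q' i j t u :=
    fun i hi j hj t u => by simp only [MatchEdge, hq i hi j hj, imp_self]
  induction hr with
  | refl => exact .refl _ _
  | up hij hs he _ ih =>
    have hsn := hs.lt.trans hi
    exact .up hij ⟨hs.lt, (hrow _ hi _ hsn).1 hs.rowLE, fun l hl hil => (hrow _ hsn _
      (hl.trans hi)).1 (hs.least l hl ((hrow _ hi _ (hl.trans hi)).2 hil))⟩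
      (hedge _ hi _ hsn _ _ he) (ih hsn hj)
  | down hij hp _ he ih =>
    have hpn := hp.lt.trans hj
    exact .down hij ⟨hp.lt, (hrow _ hpn _ hj).1 hp.rowLE, fun l hl hil => (hrow _ (hl.trans hj) _
      hpn).1 (hp.greatest l hl ((hrow _ (hl.trans hj) _ hj).2 hil))⟩ (ih hi hpn)
      (hedge _ hpn _ hj _ _ he)

theorem regLE_congr {n : ℕ} (hq : ∀ i < n, ∀ j < n, ∀ t u, q i t j u ↔ q' i t j u)
    {i j : ℕ} {t u : Fin k} (hi : i < n) (hj : j < n) : RegLE q i t j u ↔ RegLE q' i t j u :=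
  ⟨.mono_of_agree hq hi hj, .mono_of_agree (fun i hi j hj t u => (hq i hi j hj t u).symm) hi hj⟩

end Ladder

/-! ### Bounds on the width -/

section Width

variable {V : Type} [PartialOrder V] {S A : Finset V} {k : ℕ}

theorem card_le_width {T : Finset V} (hT : T ⊆ S) (ha : IsAntichain (· ≤ ·) (T : Set V)) :
    T.card ≤ width S := by
  classical
  exact Finset.le_sup (f := Finset.card) (Finset.mem_filter.2 ⟨Finset.mem_powerset.2 hT, ha⟩)

theorem width_le (h : ∀ T ⊆ S, IsAntichain (· ≤ ·) (T : Set V) → T.card ≤ k) : width S ≤ k := by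
  classical
  refine Finset.sup_le fun T hT => ?_
  rw [Finset.mem_filter, Finset.mem_powerset] at hT
  exact h T hT.1 hT.2

theorem width_le_of_chain_coloring {c : V → ℕ} (hlt : ∀ x ∈ S, c x < k)
    (hc : ∀ x ∈ S, ∀ y ∈ S, c x = c y → x ≤ y ∨ y ≤ x) : width S ≤ k := by
  refine width_le fun T hT ha => ?_
  rw [← Finset.card_range k]
  refine Finset.card_le_card_of_injOn c (fun x hx => Finset.mem_range.2 (hlt x (hT hx)))
    fun x hx y hy hxy => ?_
  rcases hc x (hT hx) y (hT hy) hxy with hle | hle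
  · exact ha.eq hx hy hle
  · exact (ha.eq hy hx hle).symm

theorem IsMaxAntichain.of_card_eq (hA : A ⊆ S) (ha : IsAntichain (· ≤ ·) (A : Set V))
    (hcard : A.card = k) (hS : width S ≤ k) : IsMaxAntichain S A :=
  ⟨hA, ha, le_antisymm (card_le_width hA ha) (hcard ▸ hS)⟩

end Width

/-! ### The regular poset of a ladder -/

section Poset

variable {k : ℕ} {q : ℕ → Fin k → ℕ → Fin k → Prop} {m : ℕ}

/-- The points of the regular poset of a ladder, a copy of `Fin m × Fin k` ordered by `RegLE`
(instead of the product order). -/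
def LadderPoint (_ : IsLadder q m) : Type := Fin m × Fin k

instance (h : IsLadder q m) : Fintype (LadderPoint h) := inferInstanceAs (Fintype (Fin m × Fin k))

instance (h : IsLadder q m) : PartialOrder (LadderPoint h) where
  le x y := RegLE q x.1 x.2 y.1 y.2
  le_refl x := .refl _ _
  le_trans x y z := h.regLE_trans x.1.isLt y.1.isLt z.1.isLt
  le_antisymm x y hxy hyx := by
    obtain ⟨h₁, h₂⟩ := h.regLE_antisymm x.1.isLt y.1.isLt hxy hyx
    exact Prod.ext (Fin.ext h₁) h₂

namespace IsLadder

variable (h : IsLadder q m)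

/-- The point number `t` of row `i`. -/
def pt (i : Fin m) (t : Fin k) : LadderPoint h := (i, t)

theorem pt_le_pt {i j : Fin m} {t u : Fin k} : h.pt i t ≤ h.pt j u ↔ RegLE q i t j u := Iff.rfl

theorem pt_inj {i j : Fin m} {t u : Fin k} : h.pt i t = h.pt j u ↔ i = j ∧ t = u := Prod.mk_inj

/-- The antichain presented in round `i`. -/
def row (i : Fin m) : Finset (LadderPoint h) :=
  Finset.univ.map ⟨h.pt i, fun _ _ e => (h.pt_inj.1 e).2⟩

theorem mem_row {i : Fin m} {x : LadderPoint h} : x ∈ h.row i ↔ ∃ t, h.pt i t = x := by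
  simp only [row, Finset.mem_map, Finset.mem_univ, true_and]
  rfl

theorem pt_mem_row {i j : Fin m} {t : Fin k} : h.pt i t ∈ h.row j ↔ i = j := by
  simp [mem_row, pt_inj, eq_comm]

theorem card_row (i : Fin m) : (h.row i).card = k := by simp [row]

theorem isAntichain_row (i : Fin m) : IsAntichain (· ≤ ·) (h.row i : Set (LadderPoint h)) := by
  rintro x hx y hy hne hle
  obtain ⟨t, rfl⟩ := h.mem_row.1 hx
  obtain ⟨u, rfl⟩ := h.mem_row.1 hy
  exact hne (congrArg _ (RegLE.eq_of_row_eq (h.pt_le_pt.1 hle)))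

theorem width_univ_le : width (Finset.univ : Finset (LadderPoint h)) ≤ k := by
  obtain ⟨c, hc⟩ := h.exists_chain_coloring (Finset.range m) (by simp)
  refine width_le_of_chain_coloring (c := fun x => c x.1 x.2) (fun x _ => Fin.isLt _)
    fun x _ y _ hxy => hc x.1 (by simp) y.1 (by simp) _ _ (Fin.ext hxy)

theorem isMaxAntichain_row (i : Fin m) : IsMaxAntichain Finset.univ (h.row i) :=
  .of_card_eq (Finset.subset_univ _) (h.isAntichain_row i) (h.card_row i) h.width_univ_le

theorem disjoint_row {i j : Fin m} (hij : i ≠ j) : Disjoint (h.row i) (h.row j) := by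
  refine Finset.disjoint_left.2 fun x hi hj => hij ?_
  obtain ⟨t, rfl⟩ := h.mem_row.1 hi
  exact h.pt_mem_row.1 hj

variable (hk : 0 < k)
include hk

theorem below_row_iff {i j : Fin m} : Below (h.row i) (h.row j) ↔ RowLE q i j := by
  constructor
  · intro hb
    obtain ⟨y, hy, hle⟩ := hb (h.pt i ⟨0, hk⟩) (h.pt_mem_row.2 rfl)
    obtain ⟨u, rfl⟩ := h.mem_row.1 hy
    exact h.rowLE_of_regLE hle
  · intro hij x hx
    obtain ⟨t, rfl⟩ := h.mem_row.1 hx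
    obtain ⟨σ, hσ⟩ := h.exists_regLE_perm i.isLt j.isLt hij
    exact ⟨h.pt j (σ t), h.pt_mem_row.2 rfl, hσ t⟩

theorem strictBelow_row_iff {i j : Fin m} :
    StrictBelow (h.row i) (h.row j) ↔ RowLE q i j ∧ i ≠ j := by
  rw [StrictBelow, h.below_row_iff hk]
  refine and_congr_right fun _ => not_congr ⟨fun e => ?_, fun e => e ▸ rfl⟩
  exact h.pt_mem_row.1 (e ▸ h.pt_mem_row.2 rfl : h.pt i ⟨0, hk⟩ ∈ h.row j)

theorem isNextAbove_iff {i s : Fin m} : IsNextAbove h.row i s ↔ NextUp q i s := by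
  constructor
  · rintro ⟨h₁, h₂, h₃⟩
    refine ⟨h₁, ((h.strictBelow_row_iff hk).1 h₂).1, fun l hl hil => ?_⟩
    have := h₃ ⟨l, hl.trans i.isLt⟩ hl ((h.strictBelow_row_iff hk).2 ⟨hil, ?_⟩)
    · exact (h.below_row_iff hk).1 this
    · exact fun e => hl.ne' (Fin.val_eq_of_eq e)
  · rintro ⟨h₁, h₂, h₃⟩
    refine ⟨h₁, (h.strictBelow_row_iff hk).2 ⟨h₂, (Fin.lt_def.2 h₁).ne'⟩, fun l hl hil => ?_⟩
    exact (h.below_row_iff hk).2 (h₃ l hl ((h.strictBelow_row_iff hk).1 hil).1)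

theorem isNextBelow_iff {i p : Fin m} : IsNextBelow h.row i p ↔ NextDown q i p := by
  constructor
  · rintro ⟨h₁, h₂, h₃⟩
    refine ⟨h₁, ((h.strictBelow_row_iff hk).1 h₂).1, fun l hl hil => ?_⟩
    have := h₃ ⟨l, hl.trans i.isLt⟩ hl ((h.strictBelow_row_iff hk).2 ⟨hil, ?_⟩)
    · exact (h.below_row_iff hk).1 this
    · exact fun e => hl.ne (Fin.val_eq_of_eq e)
  · rintro ⟨h₁, h₂, h₃⟩
    refine ⟨h₁, (h.strictBelow_row_iff hk).2 ⟨h₂, (Fin.lt_def.2 h₁).ne⟩, fun l hl hil => ?_⟩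
    exact (h.below_row_iff hk).2 (h₃ l hl ((h.strictBelow_row_iff hk).1 hil).1)

/-- Two rows between which the order consists of matching edges form a core. -/
theorem isCore_row {i j : Fin m} (hne : i ≠ j) (hij : RowLE q i j)
    (hiff : ∀ t u, RegLE q i t j u ↔ MatchEdge q i j t u) : IsCore (h.row i) (h.row j) := by
  classical
  -- A perfect matching between the rows is a partition of their union into `k` chains.
  have hdil : ∀ σ : Equiv.Perm (Fin k), (∀ t, q i t j (σ t)) →
      ∃ c : LadderPoint h → ℕ, (∀ x, c x < k) ∧ (∀ x ∈ h.row i ∪ h.row j, ∀ y ∈ h.row i ∪ h.row j,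
        c x = c y → x ≤ y ∨ y ≤ x) ∧ ∀ t, c (h.pt i t) = c (h.pt j (σ t)) := by
    intro σ hσ
    have hle : ∀ t, h.pt i t ≤ h.pt j (σ t) := fun t =>
      h.pt_le_pt.2 ((hiff _ _).2 ⟨σ, hσ, rfl⟩)
    let c : LadderPoint h → ℕ := fun x => if x.1 = j then (σ.symm x.2 : Fin k) else x.2
    have hci : ∀ t, c (h.pt i t) = t := fun t => if_neg hne
    have hcj : ∀ t, c (h.pt j t) = σ.symm t := fun t => if_pos rfl
    refine ⟨c, fun x => ?_, ?_, fun t => ?_⟩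
    · by_cases hx : x.1 = j <;> simp [c, hx]
    · intro x hx y hy hxy
      simp only [Finset.mem_union, h.mem_row] at hx hy
      rcases hx with ⟨t, rfl⟩ | ⟨t, rfl⟩ <;> rcases hy with ⟨u, rfl⟩ | ⟨u, rfl⟩ <;>
        simp only [hci, hcj, Fin.val_inj] at hxy
      · exact .inl (hxy ▸ le_rfl)
      · subst hxy; exact .inl (by simpa using hle (σ.symm u))
      · subst hxy; exact .inr (by simpa using hle (σ.symm t))
      · exact .inl (σ.symm.injective hxy ▸ le_rfl)
    · rw [hci, hcj, Equiv.symm_apply_apply]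
  obtain ⟨σ, hσ⟩ := hij
  have hw : width (h.row i ∪ h.row j) ≤ k := by
    obtain ⟨c, hlt, hc, -⟩ := hdil σ hσ
    exact width_le_of_chain_coloring (fun x _ => hlt x) hc
  have hmi : IsMaxAntichain (h.row i ∪ h.row j) (h.row i) :=
    .of_card_eq Finset.subset_union_left (h.isAntichain_row i) (h.card_row i) hw
  have hmj : IsMaxAntichain (h.row i ∪ h.row j) (h.row j) :=
    .of_card_eq Finset.subset_union_right (h.isAntichain_row j) (h.card_row j) hw
  refine ⟨⟨h.disjoint_row hne, ?_, ?_, (h.strictBelow_row_iff hk).2 ⟨⟨σ, hσ⟩, hne⟩⟩, ?_, ?_⟩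
  · convert hmi
  · convert hmj
  · rw [h.card_row, h.card_row]
  · intro x hx y hy hxy
    obtain ⟨t, rfl⟩ := h.mem_row.1 hx
    obtain ⟨u, rfl⟩ := h.mem_row.1 hy
    obtain ⟨τ, hτ, rfl⟩ := (hiff t u).1 hxy
    obtain ⟨c, hlt, hc, hct⟩ := hdil τ hτ
    have hwk : width (h.row i ∪ h.row j) = k := by rw [← hmi.card_eq, h.card_row]
    have : IsDilworthEdge (h.row i ∪ h.row j) (h.pt i t) (h.pt j (τ t)) :=
      ⟨Finset.mem_union_left _ hx, Finset.mem_union_right _ hy, c,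
        ⟨fun x _ => hwk.symm ▸ hlt x, hc⟩, hct t⟩
    convert this

theorem isRegular (hm : 0 < m) : IsRegular k h.row where
  width_eq := by rw [← (h.isMaxAntichain_row ⟨0, hm⟩).card_eq, h.card_row]
  maximum := h.isMaxAntichain_row
  cover x := ⟨x.1, h.mem_row.2 ⟨x.2, rfl⟩⟩
  disjoint _ _ := h.disjoint_row
  linear i j := by
    rw [h.below_row_iff hk, h.below_row_iff hk]; exact h.total i i.isLt j j.isLt
  core_above i s hs := by
    have hs' := (h.isNextAbove_iff hk).1 hs
    exact h.isCore_row hk hs.earlier.ne' hs'.rowLE fun _ _ => h.regLE_iff_of_nextUp i.isLt hs'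
  core_below i p hp := by
    have hp' := (h.isNextBelow_iff hk).1 hp
    exact h.isCore_row hk hp.earlier.ne hp'.rowLE fun _ _ => h.regLE_iff_of_nextDown i.isLt hp'
  trans_above i j hji x hx y hy hxy := by
    obtain ⟨t, rfl⟩ := h.mem_row.1 hx
    obtain ⟨u, rfl⟩ := h.mem_row.1 hy
    have hji' : (j : ℕ) < i := hji
    obtain ⟨s, v, hs, he, hr⟩ : ∃ s v, NextUp q i s ∧ MatchEdge q i s t v ∧ RegLE q s v j u := by
      have hr := h.pt_le_pt.1 hxy.le
      generalize (i : ℕ) = i', (j : ℕ) = j' at hr hji'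
      cases hr with
      | refl => omega
      | down => omega
      | up _ hs he hr => exact ⟨_, _, hs, he, hr⟩
    have hsm := hs.lt.trans i.isLt
    refine ⟨⟨s, hsm⟩, (h.isNextAbove_iff hk).2 hs, h.pt ⟨s, hsm⟩ v, h.pt_mem_row.2 rfl, ?_, hr⟩
    refine lt_of_le_of_ne (RegLE.up hs.lt hs he (.refl _ _)) fun e => hs.lt.ne' ?_
    exact Fin.val_eq_of_eq (h.pt_inj.1 e).1
  trans_below i j hij x hx y hy hxy := by
    obtain ⟨t, rfl⟩ := h.mem_row.1 hx
    obtain ⟨u, rfl⟩ := h.mem_row.1 hy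
    have hij' : (i : ℕ) < j := by
      refine lt_of_le_of_ne hij fun e => hxy.ne ?_
      obtain rfl := Fin.ext e
      exact congrArg _ (RegLE.eq_of_row_eq (h.pt_le_pt.1 hxy.le))
    obtain ⟨p, v, hp, he, hr⟩ : ∃ p v, NextDown q j p ∧ MatchEdge q p j v u ∧ RegLE q i t p v := by
      have hr := h.pt_le_pt.1 hxy.le
      generalize (i : ℕ) = i', (j : ℕ) = j' at hr hij'
      cases hr with
      | refl => omega
      | up => omega
      | down _ hp hr he => exact ⟨_, _, hp, he, hr⟩
    have hpm := hp.lt.trans j.isLt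
    refine ⟨⟨p, hpm⟩, (h.isNextBelow_iff hk).2 hp, h.pt ⟨p, hpm⟩ v, h.pt_mem_row.2 rfl, hr, ?_⟩
    refine lt_of_le_of_ne (RegLE.down hp.lt hp (.refl _ _) he) fun e => hp.lt.ne ?_
    exact Fin.val_eq_of_eq (h.pt_inj.1 e).1

end IsLadder

end Poset

/-! ### The lattice of maximum antichains -/

section Lattice

variable {α : Type} {r : α → α → Prop} {W : Set α} {k : ℕ} {A B C : Finset α}

/-- Every finite antichain contained in `W` has at most `k` points. The order is a relation `r`, as
the points of a presented poset are named by natural numbers. -/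
def WidthLE (r : α → α → Prop) (W : Set α) (k : ℕ) : Prop :=
  ∀ T : Finset α, ↑T ⊆ W → IsAntichain r (T : Set α) → T.card ≤ k

/-- `A ⊆ W` is an antichain with `k` points; it is a maximum antichain if `WidthLE r W k`. -/
structure IsKAntichain (r : α → α → Prop) (W : Set α) (k : ℕ) (A : Finset α) : Prop where
  subset : ↑A ⊆ W
  antichain : IsAntichain r (A : Set α)
  card : A.card = k

/-- `A ⊑ B` for a relation `r`. -/
def RelBelow (r : α → α → Prop) (A B : Finset α) : Prop :=
  ∀ a ∈ A, ∃ b ∈ B, r a b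

open Classical in
/-- The maximal elements of `A ∪ B`, which form the join of `A` and `B` in the lattice of maximum
antichains. The meet is the join for the reversed relation. -/
noncomputable def joinAntichain (r : α → α → Prop) (A B : Finset α) : Finset α :=
  (A ∪ B).filter fun x => ∀ y ∈ A ∪ B, r x y → y = x

theorem isAntichain_flip {S : Set α} : IsAntichain (flip r) S ↔ IsAntichain r S :=
  ⟨fun h => h.flip, fun h => h.flip⟩

theorem WidthLE.flip (hW : WidthLE r W k) : WidthLE (flip r) W k :=
  fun T hT ha => hW T hT (isAntichain_flip.1 ha)

theorem IsKAntichain.flip (hA : IsKAntichain r W k A) : IsKAntichain (flip r) W k A :=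
  ⟨hA.subset, isAntichain_flip.2 hA.antichain, hA.card⟩

theorem IsKAntichain.unflip (hA : IsKAntichain (_root_.flip r) W k A) : IsKAntichain r W k A :=
  ⟨hA.subset, isAntichain_flip.1 hA.antichain, hA.card⟩

theorem isAntichain_joinAntichain : IsAntichain r (joinAntichain r A B : Set α) := by
  intro x hx y hy hne hxy
  simp only [joinAntichain, Finset.coe_filter, Set.mem_ofPred_eq] at hx hy
  exact hne (hx.2 y hy.1 hxy).symm

theorem joinAntichain_comm : joinAntichain r A B = joinAntichain r B A := by
  classical
  simp only [joinAntichain, Finset.union_comm A B]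

theorem join_relBelow (hA : RelBelow r A C) (hB : RelBelow r B C) :
    RelBelow r (joinAntichain r A B) C := by
  intro x hx
  simp only [joinAntichain, Finset.mem_filter, Finset.mem_union] at hx
  exact hx.1.elim (hA x) (hB x)

variable [IsPartialOrder α r]

theorem isPartialOrder_flip : IsPartialOrder α (flip r) where
  refl a := refl_of r a
  trans _ _ _ h₁ h₂ := trans_of r h₂ h₁
  antisymm _ _ h₁ h₂ := antisymm_of r h₂ h₁

theorem RelBelow.trans (h₁ : RelBelow r A B) (h₂ : RelBelow r B C) : RelBelow r A C := by
  intro a ha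
  obtain ⟨b, hb, hab⟩ := h₁ a ha
  obtain ⟨c, hc, hbc⟩ := h₂ b hb
  exact ⟨c, hc, trans_of r hab hbc⟩

theorem RelBelow.subset_of_antichain (hA : IsAntichain r (A : Set α)) (h₁ : RelBelow r A B)
    (h₂ : RelBelow r B A) : A ⊆ B := by
  intro a ha
  obtain ⟨b, hb, hab⟩ := h₁ a ha
  obtain ⟨a', ha', hba⟩ := h₂ b hb
  obtain rfl := hA.eq ha ha' (trans_of r hab hba)
  rwa [antisymm_of r hab hba]

/-- Hall's condition for the comparability graph between `A ⊑ B`: otherwise a set in `A` together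
with its non-neighbours in `B` is too large an antichain. -/
theorem card_le_card_neighbours [DecidableEq α] [DecidableRel r] (hW : WidthLE r W k)
    (hA : IsKAntichain r W k A) (hB : IsKAntichain r W k B) (hAB : RelBelow r A B)
    {S : Finset α} (hS : S ⊆ A) : S.card ≤ (B.filter fun b => ∃ a ∈ S, r a b).card := by
  have hanti : IsAntichain r (↑(S ∪ B.filter fun b => ¬ ∃ a ∈ S, r a b) : Set α) := by
    have key : ∀ a ∈ S, ∀ b ∈ B, (¬ ∃ a ∈ S, r a b) → ¬ r b a := by
      intro a ha b hb hn hba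
      obtain ⟨b', hb', hab'⟩ := hAB a (hS ha)
      obtain rfl := hB.antichain.eq hb hb' (trans_of r hba hab')
      exact hn ⟨a, ha, hab'⟩
    intro x hx y hy hne
    simp only [Finset.coe_union, Set.mem_union, Finset.mem_coe, Finset.mem_filter] at hx hy
    rcases hx with hx | ⟨hx, hnx⟩ <;> rcases hy with hy | ⟨hy, hny⟩
    · exact hA.antichain (hS hx) (hS hy) hne
    · exact fun h => hny ⟨x, hx, h⟩
    · exact key y hy x hx hnx
    · exact hB.antichain hx hy hne
  have hcard := hW _ (by
    intro x hx
    simp only [Finset.coe_union, Set.mem_union, Finset.mem_coe, Finset.mem_filter] at hx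
    rcases hx with hx | hx
    · exact hA.subset (hS hx)
    · exact hB.subset hx.1) hanti
  rw [Finset.card_union_of_disjoint] at hcard
  · have := Finset.card_filter_add_card_filter_not (s := B) (fun b => ∃ a ∈ S, r a b)
    have := hB.card
    omega
  · refine Finset.disjoint_left.2 fun x hx hx' => (Finset.mem_filter.1 hx').2 ⟨x, hx, refl_of r x⟩

/-- For maximum antichains, lying in the downset of `B` and having `B` in the upset amount to the
same. -/
theorem RelBelow.flip (hW : WidthLE r W k) (hA : IsKAntichain r W k A) (hB : IsKAntichain r W k B)
    (hAB : RelBelow r A B) : RelBelow (_root_.flip r) B A := by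
  classical
  intro b hb
  have h := card_le_card_neighbours hW hA hB hAB subset_rfl
  rw [hA.card, ← hB.card] at h
  have := Finset.eq_of_subset_of_card_le (Finset.filter_subset _ _) h
  rw [← this] at hb
  exact (Finset.mem_filter.1 hb).2

theorem RelBelow.unflip (hW : WidthLE r W k) (hA : IsKAntichain r W k A)
    (hB : IsKAntichain r W k B) (hAB : RelBelow (_root_.flip r) A B) : RelBelow r B A :=
  have := isPartialOrder_flip (r := r)
  RelBelow.flip (r := _root_.flip r) hW.flip hA.flip hB.flip hAB

/-- Enumerations of maximum antichains `A ⊑ B` are matched by a permutation. -/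
theorem RelBelow.exists_perm (hW : WidthLE r W k) (hA : IsKAntichain r W k A)
    (hB : IsKAntichain r W k B) (hAB : RelBelow r A B) {f g : Fin k → α} (hf : f.Injective)
    (hfA : ∀ t, f t ∈ A) (hgB : ∀ b ∈ B, ∃ t, g t = b) :
    ∃ σ : Equiv.Perm (Fin k), ∀ t, r (f t) (g (σ t)) := by
  classical
  obtain ⟨φ, hφ, hφr⟩ := (Finset.all_card_le_biUnion_card_iff_exists_injective
    fun t => B.filter fun b => r (f t) b).1 fun s => by
      have h := card_le_card_neighbours hW hA hB hAB (S := s.image f) (by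
        intro x hx
        obtain ⟨t, -, rfl⟩ := Finset.mem_image.1 hx
        exact hfA t)
      rw [Finset.card_image_of_injective _ hf] at h
      refine h.trans (Finset.card_le_card fun b hb => ?_)
      simp only [Finset.mem_filter, Finset.mem_image, exists_exists_and_eq_and] at hb
      obtain ⟨hb, t, ht, htb⟩ := hb
      exact Finset.mem_biUnion.2 ⟨t, ht, Finset.mem_filter.2 ⟨hb, htb⟩⟩
  simp only [Finset.mem_filter] at hφr
  choose σ hσ using fun t => hgB (φ t) (hφr t).1
  have hinj : σ.Injective := fun t u e => hφ (by rw [← hσ, ← hσ, e])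
  refine ⟨Equiv.ofBijective σ (Finite.injective_iff_bijective.1 hinj), fun t => ?_⟩
  rw [Equiv.ofBijective_apply, hσ]
  exact (hφr t).2

theorem relBelow_join_left (hA : IsAntichain r (A : Set α)) (hB : IsAntichain r (B : Set α)) :
    RelBelow r A (joinAntichain r A B) := by
  classical
  intro a ha
  by_cases h : ∃ b ∈ B, r a b
  · obtain ⟨b, hb, hab⟩ := h
    refine ⟨b, ?_, hab⟩
    simp only [joinAntichain, Finset.mem_filter, Finset.mem_union]
    refine ⟨.inr hb, ?_⟩
    rintro y (hy | hy) hby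
    · obtain rfl := hA.eq ha hy (trans_of r hab hby)
      exact antisymm_of r hab hby
    · exact (hB.eq hb hy hby).symm
  · refine ⟨a, ?_, refl_of r a⟩
    simp only [joinAntichain, Finset.mem_filter, Finset.mem_union]
    refine ⟨.inl ha, ?_⟩
    rintro y (hy | hy) hay
    · exact (hA.eq ha hy hay).symm
    · exact absurd ⟨y, hy, hay⟩ h

/-- The maximal elements of the union of two maximum antichains form a maximum antichain: together
with the minimal ones, they cover the union, and they cover the intersection twice. -/
theorem IsKAntichain.join (hW : WidthLE r W k) (hA : IsKAntichain r W k A)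
    (hB : IsKAntichain r W k B) : IsKAntichain r W k (joinAntichain r A B) := by
  classical
  have hsub : ∀ s : α → α → Prop, (↑(joinAntichain s A B) : Set α) ⊆ W := by
    intro s x hx
    simp only [joinAntichain, Finset.mem_coe, Finset.mem_filter, Finset.mem_union] at hx
    exact hx.1.elim (fun h => hA.subset h) fun h => hB.subset h
  have hle := hW _ (hsub r) isAntichain_joinAntichain
  have hle' := hW _ (hsub (_root_.flip r)) (isAntichain_flip.1 isAntichain_joinAntichain)
  refine ⟨hsub r, isAntichain_joinAntichain, le_antisymm hle ?_⟩
  have hunion : A ∪ B ⊆ joinAntichain r A B ∪ joinAntichain (_root_.flip r) A B := by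
    intro x hx
    simp only [joinAntichain, Finset.mem_filter, ← Finset.filter_or, hx, true_and]
    by_contra! h
    obtain ⟨⟨y, hy, hxy, hyx⟩, z, hz, hzx, hzx'⟩ := h
    change r z x at hzx
    have hzy := trans_of r hzx hxy
    -- One of the three points of the chain `z < x < y` shares an antichain with another.
    rw [Finset.mem_union] at hx hy hz
    have hA' := fun {a b} (ha : a ∈ A) (hb : b ∈ A) (h : r a b) => hA.antichain.eq ha hb h
    have hB' := fun {a b} (ha : a ∈ B) (hb : b ∈ B) (h : r a b) => hB.antichain.eq ha hb h
    have hzy' : z ≠ y := fun e => hyx (antisymm_of r (e ▸ hzx) hxy)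
    rcases hx with hx | hx <;> rcases hy with hy | hy <;> rcases hz with hz | hz <;>
      first
        | exact hyx (hA' hx hy hxy).symm
        | exact hyx (hB' hx hy hxy).symm
        | exact hzx' (hA' hz hx hzx)
        | exact hzx' (hB' hz hx hzx)
        | exact hzy' (hA' hz hy hzy)
        | exact hzy' (hB' hz hy hzy)
  have hinter : A ∩ B ⊆ joinAntichain r A B ∩ joinAntichain (_root_.flip r) A B := by
    intro x hx
    rw [Finset.mem_inter] at hx
    simp only [joinAntichain, Finset.mem_inter, Finset.mem_filter, Finset.mem_union]
    refine ⟨⟨.inl hx.1, ?_⟩, .inl hx.1, ?_⟩ <;> rintro y (hy | hy) hxy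
    · exact (hA.antichain.eq hx.1 hy hxy).symm
    · exact (hB.antichain.eq hx.2 hy hxy).symm
    · exact hA.antichain.eq hy hx.1 hxy
    · exact hB.antichain.eq hy hx.2 hxy
  have h₁ := Finset.card_le_card hunion
  have h₂ := Finset.card_le_card hinter
  have h₃ := Finset.card_union_add_card_inter A B
  have h₄ := Finset.card_union_add_card_inter (joinAntichain r A B)
    (joinAntichain (_root_.flip r) A B)
  have := hA.card
  have := hB.card
  omega

/-- Joining a maximum antichain through `n` with maximum antichains that have a point below `n`
keeps `n`. -/
theorem exists_above_all (hW : WidthLE r W k) {n : α} (𝓓 𝓤 : Finset (Finset α))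
    (hD : ∀ R ∈ 𝓓, IsKAntichain r W k R ∧ (∃ x ∈ R, r x n) ∧ ∀ U ∈ 𝓤, RelBelow r R U)
    (hB : IsKAntichain r W k B) (hn : n ∈ B) (hU : ∀ U ∈ 𝓤, RelBelow r B U) :
    ∃ C, IsKAntichain r W k C ∧ n ∈ C ∧ (∀ R ∈ 𝓓, RelBelow r R C) ∧ ∀ U ∈ 𝓤, RelBelow r C U := by
  classical
  induction 𝓓 using Finset.induction_on with
  | empty => exact ⟨B, hB, hn, by simp, hU⟩
  | insert R 𝓓 _ ih =>
    simp only [Finset.mem_insert, forall_eq_or_imp] at hD ⊢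
    obtain ⟨⟨hR, ⟨x, hx, hxn⟩, hRU⟩, hD⟩ := hD
    obtain ⟨C, hC, hnC, hDC, hCU⟩ := ih hD
    have hRC := hR.join hW hC
    refine ⟨joinAntichain r R C, hRC, ?_, ⟨relBelow_join_left hR.antichain hC.antichain,
      fun D hD' => (hDC D hD').trans ?_⟩, fun U hU' => join_relBelow (hRU U hU') (hCU U hU')⟩
    · simp only [joinAntichain, Finset.mem_filter, Finset.mem_union]
      refine ⟨.inr hnC, ?_⟩
      rintro y (hy | hy) hny
      · obtain rfl := hR.antichain.eq hx hy (trans_of r hxn hny)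
        exact antisymm_of r hxn hny
      · exact (hC.antichain.eq hnC hy hny).symm
    · rw [joinAntichain_comm]
      exact relBelow_join_left hC.antichain hR.antichain

/-- A `⊑`-chain of maximum antichains avoiding `n` extends by a maximum antichain through `n`, as soon
as there is any such antichain. -/
theorem exists_comparable_to_all (hW : WidthLE r W k) {n : α} (hnW : n ∈ W)
    (𝓡 : Finset (Finset α)) (hR : ∀ R ∈ 𝓡, IsKAntichain r W k R) (hnR : ∀ R ∈ 𝓡, n ∉ R)
    (hlin : ∀ R ∈ 𝓡, ∀ R' ∈ 𝓡, RelBelow r R R' ∨ RelBelow r R' R)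
    (hB : IsKAntichain r W k B) (hn : n ∈ B) :
    ∃ C, IsKAntichain r W k C ∧ n ∈ C ∧ ∀ R ∈ 𝓡, RelBelow r C R ∨ RelBelow r R C := by
  classical
  have hcomp : ∀ R ∈ 𝓡, (∃ x ∈ R, r x n) ∨ ∃ x ∈ R, r n x := by
    intro R hR'
    by_contra! h
    have hanti : IsAntichain r (↑(insert n R) : Set α) := by
      rw [Finset.coe_insert, isAntichain_insert]
      exact ⟨(hR R hR').antichain, fun x hx _ => ⟨h.2 x hx, h.1 x hx⟩⟩
    have := hW _ (by
      rw [Finset.coe_insert]; exact Set.insert_subset hnW (hR R hR').subset) hanti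
    rw [Finset.card_insert_of_notMem (hnR R hR'), (hR R hR').card] at this
    omega
  obtain ⟨𝓓, h𝓓⟩ : ∃ 𝓓 : Finset (Finset α), ∀ R, R ∈ 𝓓 ↔ R ∈ 𝓡 ∧ ∃ x ∈ R, r x n :=
    ⟨𝓡.filter fun R => ∃ x ∈ R, r x n, fun R => Finset.mem_filter⟩
  obtain ⟨𝓤, h𝓤⟩ : ∃ 𝓤 : Finset (Finset α), ∀ R, R ∈ 𝓤 ↔ R ∈ 𝓡 ∧ ∃ x ∈ R, r n x :=
    ⟨𝓡.filter fun R => ∃ x ∈ R, r n x, fun R => Finset.mem_filter⟩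
  have hDU : ∀ R ∈ 𝓓, ∀ U ∈ 𝓤, RelBelow r R U := by
    intro R hRD U hU
    obtain ⟨hR', x, hx, hxn⟩ := (h𝓓 R).1 hRD
    obtain ⟨hU', y, hy, hny⟩ := (h𝓤 U).1 hU
    refine (hlin R hR' U hU').resolve_right fun hUR => hnR R hR' ?_
    obtain ⟨x', hx', hyx'⟩ := hUR y hy
    have hnx' := trans_of r hny hyx'
    obtain rfl := (hR R hR').antichain.eq hx hx' (trans_of r hxn hnx')
    rwa [antisymm_of r hnx' hxn]
  have hDk : ∀ R ∈ 𝓓, IsKAntichain r W k R := fun R h => hR R ((h𝓓 R).1 h).1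
  have hUk : ∀ U ∈ 𝓤, IsKAntichain r W k U := fun U h => hR U ((h𝓤 U).1 h).1
  obtain ⟨C, hC, hnC, hDC, -⟩ := exists_above_all hW 𝓓 ∅
    (fun R h => ⟨hDk R h, ((h𝓓 R).1 h).2, by simp⟩) hB hn (by simp)
  have := isPartialOrder_flip (r := r)
  -- The meets with the antichains above `n` are joins in the reversed order.
  obtain ⟨E, hE, hnE, hUE, hED⟩ := exists_above_all (r := flip r) hW.flip 𝓤 𝓓
    (fun U h => ⟨(hUk U h).flip, ((h𝓤 U).1 h).2,
      fun R hR' => (hDU R hR' U h).flip hW (hDk R hR') (hUk U h)⟩) hC.flip hnC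
    (fun R hR' => (hDC R hR').flip hW (hDk R hR') hC)
  refine ⟨E, hE.unflip, hnE, fun R hR' => ?_⟩
  rcases hcomp R hR' with h | h
  · have hRD : R ∈ 𝓓 := (h𝓓 R).2 ⟨hR', h⟩
    exact .inr ((hED R hRD).unflip hW hE.unflip (hR R hR'))
  · have hRU : R ∈ 𝓤 := (h𝓤 R).2 ⟨hR', h⟩
    exact .inl ((hUE R hRU).unflip hW (hR R hR') hE.unflip)

end Lattice

/-! ### Levels -/

section Level

variable {r r' : ℕ → ℕ → Prop} {n k : ℕ}

/-- The level of the point `n`, where points are named by the time of their presentation: the least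
`k` such that, for every `l ≥ k`, adding `n` to the earlier points of level at most `l` gives a set
of width at most `l`. Asking this for all `l ≥ k` and not only for `k` makes the points of level at
most `k` a set of width at most `k`. -/
noncomputable def level (r : ℕ → ℕ → Prop) (n : ℕ) : ℕ :=
  sInf {k | ∀ l ≥ k, ∀ T : Finset ℕ, (∀ i ∈ T, i = n ∨ ∃ _ : i < n, level r i ≤ l) →
    IsAntichain r (T : Set ℕ) → T.card ≤ l}
termination_by n

theorem level_le_iff : level r n ≤ k ↔
    ∀ l ≥ k, WidthLE r {i | i = n ∨ i < n ∧ level r i ≤ l} l := by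
  have hne : {k | ∀ l ≥ k, ∀ T : Finset ℕ, (∀ i ∈ T, i = n ∨ ∃ _ : i < n, level r i ≤ l) →
      IsAntichain r (T : Set ℕ) → T.card ≤ l}.Nonempty := by
    refine ⟨n + 1, fun l hl T hT _ => le_trans ?_ hl⟩
    rw [← Finset.card_range (n + 1)]
    refine Finset.card_le_card fun i hi => Finset.mem_range.2 ?_
    rcases hT i hi with rfl | ⟨hi, -⟩ <;> omega
  have hset := Nat.sInf_mem hne
  rw [← level] at hset
  constructor
  · intro hk l hl T hT ha
    exact hset l (hk.trans hl) T (fun i hi => (hT hi).imp_right fun h => ⟨h.1, h.2⟩) ha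
  · intro h
    rw [level]
    exact Nat.sInf_le fun l hl T hT ha => h l hl T
      (fun i hi => (hT i hi).imp_right fun ⟨h₁, h₂⟩ => ⟨h₁, h₂⟩) ha

theorem widthLE_level_le (r : ℕ → ℕ → Prop) (k : ℕ) : WidthLE r {i | level r i ≤ k} k := by
  intro T hT ha
  rcases T.eq_empty_or_nonempty with rfl | hne
  · simp
  -- The point of `T` presented last was allowed to join the levels up to `k`.
  refine level_le_iff.1 (hT (T.max'_mem hne)) k le_rfl T (fun i hi => ?_) ha
  exact (T.le_max' i hi).eq_or_lt.imp_right fun h => ⟨h, hT hi⟩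

theorem level_pos (r : ℕ → ℕ → Prop) (n : ℕ) : 0 < level r n := by
  by_contra! h
  have := level_le_iff.1 h 0 le_rfl {n} (by simp) (by simp)
  simp at this

theorem level_le_of_widthLE {w : ℕ} (h : WidthLE r {i | i ≤ n} w) : level r n ≤ w := by
  refine level_le_iff.2 fun l hl T hT ha => (h T (fun i hi => ?_) ha).trans hl
  exact (hT hi).elim (fun h => h.le) fun h => h.1.le

/-- A point is refused by the lower levels because it completes an antichain that is too large for
them. -/
theorem exists_isKAntichain (r : ℕ → ℕ → Prop) (n : ℕ) :
    ∃ B, IsKAntichain r {i | i ≤ n ∧ level r i ≤ level r n} (level r n) B ∧ n ∈ B := by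
  obtain ⟨k, hk⟩ : ∃ k, level r n = k + 1 := Nat.exists_eq_succ_of_ne_zero (level_pos r n).ne'
  have h : ¬ level r n ≤ k := by omega
  rw [level_le_iff] at h
  push Not at h
  obtain ⟨l, hl, hW⟩ := h
  obtain rfl : l = k := by
    refine le_antisymm ?_ hl
    by_contra! hlk
    exact hW (level_le_iff.1 hk.le l hlk)
  simp only [WidthLE, not_forall] at hW
  obtain ⟨T, hT, ha, hcard⟩ := hW
  rw [hk]
  have hTk : (T : Set ℕ) ⊆ {i | i ≤ n ∧ level r i ≤ l + 1} := by
    intro i hi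
    rcases hT hi with rfl | hi
    · exact ⟨le_rfl, hk.le⟩
    · exact ⟨hi.1.le, hi.2.trans (Nat.le_succ _)⟩
  have hle := widthLE_level_le r (l + 1) T (fun i hi => (hTk hi).2) ha
  refine ⟨T, ⟨hTk, ha, by omega⟩, ?_⟩
  by_contra hn
  refine hcard (widthLE_level_le r l T (fun i hi => ?_) ha)
  rcases hT hi with rfl | hi
  · exact absurd hi hn
  · exact hi.2

/-- The level of a point is determined on-line. -/
theorem level_congr (h : ∀ i ≤ n, ∀ j ≤ n, (r i j ↔ r' i j)) : level r n = level r' n := by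
  induction n using Nat.strong_induction_on with
  | _ n ih =>
    have hl : ∀ i < n, level r i = level r' i := fun i hi => ih i hi fun a ha b hb =>
      h a (ha.trans hi.le) b (hb.trans hi.le)
    refine eq_of_forall_ge_iff fun k => ?_
    rw [level_le_iff, level_le_iff]
    refine forall₂_congr fun l _ => forall_congr' fun T => ?_
    have hset : {i | i = n ∨ i < n ∧ level r i ≤ l} = {i | i = n ∨ i < n ∧ level r' i ≤ l} := by
      ext i
      exact or_congr_right (and_congr_right fun hi => by rw [hl i hi])
    rw [hset]
    refine forall_congr' fun hT => imp_congr_left ?_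
    have hTn : ∀ i ∈ T, i ≤ n := fun i hi => by
      rcases hT hi with rfl | hi
      · exact le_rfl
      · exact hi.1.le
    exact forall₂_congr fun i hi => forall₂_congr fun j hj => imp_congr_right fun _ =>
      not_congr (h i (hTn i hi) j (hTn j hj))

/-- An antichain of `k` points, all of level at most `k`, that contains the point `n` of level `k`,
has no point presented after `n`, and is `⊑`-comparable to the antichains chosen at earlier points
of level `k`. If `n` has another level, the value is arbitrary. -/
noncomputable def levelAntichain (r : ℕ → ℕ → Prop) (k n : ℕ) : Finset ℕ :=
  Classical.epsilon fun A => IsKAntichain r {i | i ≤ n ∧ level r i ≤ k} k A ∧ n ∈ A ∧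
    ∀ j, ∀ _ : j < n, level r j = k →
      RelBelow r A (levelAntichain r k j) ∨ RelBelow r (levelAntichain r k j) A
termination_by n

theorem levelAntichain_spec [IsPartialOrder ℕ r] (hn : level r n = k) :
    IsKAntichain r {i | i ≤ n ∧ level r i ≤ k} k (levelAntichain r k n) ∧
      n ∈ levelAntichain r k n ∧ ∀ j < n, level r j = k →
      RelBelow r (levelAntichain r k n) (levelAntichain r k j) ∨
        RelBelow r (levelAntichain r k j) (levelAntichain r k n) := by
  classical
  induction n using Nat.strong_induction_on with
  | _ n ih =>
    rw [levelAntichain]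
    refine Classical.epsilon_spec (p := fun A => IsKAntichain r {i | i ≤ n ∧ level r i ≤ k} k A ∧
      n ∈ A ∧ ∀ j, ∀ _ : j < n, level r j = k →
      RelBelow r A (levelAntichain r k j) ∨ RelBelow r (levelAntichain r k j) A) ?_
    obtain ⟨B, hB, hnB⟩ := exists_isKAntichain r n
    rw [hn] at hB
    have hW : WidthLE r {i | i ≤ n ∧ level r i ≤ k} k := fun T hT ha =>
      widthLE_level_le r k T (fun i hi => (hT hi).2) ha
    obtain ⟨J, hJ⟩ : ∃ J : Finset ℕ, ∀ j, j ∈ J ↔ j < n ∧ level r j = k :=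
      ⟨(Finset.range n).filter fun j => level r j = k, by simp⟩
    have hka : ∀ R ∈ J.image (levelAntichain r k),
        IsKAntichain r {i | i ≤ n ∧ level r i ≤ k} k R ∧ n ∉ R := by
      intro R hR
      obtain ⟨j, hj, rfl⟩ := Finset.mem_image.1 hR
      obtain ⟨hjn, hjk⟩ := (hJ j).1 hj
      obtain ⟨h, -⟩ := ih j hjn hjk
      exact ⟨⟨fun i hi => ⟨(h.subset hi).1.trans hjn.le, (h.subset hi).2⟩, h.antichain, h.card⟩,
        fun hi => hjn.not_ge (h.subset hi).1⟩
    have hlin : ∀ R ∈ J.image (levelAntichain r k), ∀ R' ∈ J.image (levelAntichain r k),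
        RelBelow r R R' ∨ RelBelow r R' R := by
      intro R hR R' hR'
      obtain ⟨i, hi, rfl⟩ := Finset.mem_image.1 hR
      obtain ⟨j, hj, rfl⟩ := Finset.mem_image.1 hR'
      obtain ⟨hin, hik⟩ := (hJ i).1 hi
      obtain ⟨hjn, hjk⟩ := (hJ j).1 hj
      rcases lt_trichotomy i j with hij | rfl | hij
      · exact ((ih j hjn hjk).2.2 i hij hik).symm
      · exact .inl fun a ha => ⟨a, ha, refl_of r a⟩
      · exact (ih i hin hik).2.2 j hij hjk
    obtain ⟨C, hC, hnC, hCJ⟩ := exists_comparable_to_all hW (n := n) ⟨le_rfl, hn.le⟩ _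
      (fun R hR => (hka R hR).1) (fun R hR => (hka R hR).2) hlin hB hnB
    exact ⟨C, hC, hnC, fun j hj hjk => hCJ _ (Finset.mem_image_of_mem _ ((hJ j).2 ⟨hj, hjk⟩))⟩

theorem IsKAntichain.congr {W : Set ℕ} {A : Finset ℕ}
    (h : ∀ i ≤ n, ∀ j ≤ n, (r i j ↔ r' i j)) (hW : ∀ i ∈ W, i ≤ n) (hA : IsKAntichain r W k A) :
    IsKAntichain r' W k A :=
  ⟨hA.subset, fun i hi j hj hij hr => hA.antichain hi hj hij
    ((h i (hW i (hA.subset hi)) j (hW j (hA.subset hj))).2 hr), hA.card⟩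

theorem RelBelow.congr {A B : Finset ℕ} (h : ∀ i ≤ n, ∀ j ≤ n, (r i j ↔ r' i j))
    (hA : ∀ i ∈ A, i ≤ n) (hB : ∀ i ∈ B, i ≤ n) : RelBelow r A B ↔ RelBelow r' A B :=
  forall₂_congr fun i hi => exists_congr fun j => and_congr_right fun hj =>
    h i (hA i hi) j (hB j hj)

/-- The chosen antichain is determined on-line. -/
theorem levelAntichain_congr [IsPartialOrder ℕ r] (h : ∀ i ≤ n, ∀ j ≤ n, (r i j ↔ r' i j)) :
    levelAntichain r k n = levelAntichain r' k n := by
  induction n using Nat.strong_induction_on with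
  | _ n ih =>
    have hrow : ∀ j < n, levelAntichain r k j = levelAntichain r' k j := fun j hj =>
      ih j hj fun a ha b hb => h a (ha.trans hj.le) b (hb.trans hj.le)
    have hlev : ∀ j ≤ n, level r j = level r' j := fun j hj =>
      level_congr fun a ha b hb => h a (ha.trans hj) b (hb.trans hj)
    rw [levelAntichain, levelAntichain]
    congr 1
    funext A
    have hset : {i | i ≤ n ∧ level r i ≤ k} = {i | i ≤ n ∧ level r' i ≤ k} := by
      ext i
      exact and_congr_right fun hi => by rw [hlev i hi]
    rw [← hset]
    refine propext ((and_congr_left' ⟨.congr h fun i hi => hi.1,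
      .congr (fun i hi j hj => (h i hi j hj).symm) fun i hi => hi.1⟩).trans
      (and_congr_right fun hA => and_congr_right fun _ => forall₂_congr fun j hj => ?_))
    rw [← hlev j hj.le, ← hrow j hj]
    refine imp_congr_right fun hjk => ?_
    have hj' : ∀ i ∈ levelAntichain r k j, i ≤ n := fun i hi =>
      ((levelAntichain_spec hjk).1.subset hi).1.trans hj.le
    have hA' : ∀ i ∈ A, i ≤ n := fun i hi => (hA.subset hi).1
    exact or_congr (RelBelow.congr h hA' hj') (RelBelow.congr h hj' hA')

end Level

/-! ### The antichains presented for one level -/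

section Rounds

variable {r r' : ℕ → ℕ → Prop} {n k : ℕ}

/-- The increasing enumeration of a set with `k` elements (constantly `0` if `A` has another size).
-/
noncomputable def enum (A : Finset ℕ) (k : ℕ) (t : Fin k) : ℕ :=
  if h : A.card = k then A.orderEmbOfFin h t else 0

theorem enum_injective {A : Finset ℕ} (h : A.card = k) : (enum A k).Injective := by
  intro t u e
  simpa [enum, h] using e

theorem enum_mem {A : Finset ℕ} (h : A.card = k) (t : Fin k) : enum A k t ∈ A := by
  simp [enum, h]

theorem exists_enum_eq {A : Finset ℕ} (h : A.card = k) {a : ℕ} (ha : a ∈ A) :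
    ∃ t, enum A k t = a := by
  rw [← Finset.mem_coe, ← A.range_orderEmbOfFin h] at ha
  obtain ⟨t, ht⟩ := ha
  exact ⟨t, by simpa [enum, h] using ht⟩

/-- The time at which the `i`-th point of level `k` is presented. Only values below the number of
such points are meaningful. -/
noncomputable def roundTime (r : ℕ → ℕ → Prop) (k i : ℕ) : ℕ :=
  Nat.nth (fun n => level r n = k) i

open Classical in
/-- The number of points of level `k` presented before time `n`. If `n` itself has level `k`, this
is the round in which its antichain is presented to the algorithm for level `k`. -/
noncomputable def roundCount (r : ℕ → ℕ → Prop) (k n : ℕ) : ℕ :=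
  Nat.count (fun n => level r n = k) n

/-- The points of the antichain presented in round `i` to the algorithm for level `k`. -/
noncomputable def roundPoint (r : ℕ → ℕ → Prop) (k i : ℕ) : Fin k → ℕ :=
  enum (levelAntichain r k (roundTime r k i)) k

/-- The order of the original poset between points of the presented antichains. Different pairs `(i,
t)` may stand for the same point, so this is only a preorder. -/
def roundRel (r : ℕ → ℕ → Prop) (k i : ℕ) (t : Fin k) (j : ℕ) (u : Fin k) : Prop :=
  r (roundPoint r k i t) (roundPoint r k j u)

theorem roundTime_roundCount (hn : level r n = k) : roundTime r k (roundCount r k n) = n := by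
  classical
  unfold roundTime roundCount
  convert Nat.nth_count (p := fun n => level r n = k) hn

theorem roundTime_lt {i : ℕ} (hi : i < roundCount r k n) : roundTime r k i < n := by
  classical
  exact Nat.nth_lt_of_lt_count hi

theorem lt_card_of_lt_roundCount {i : ℕ} (hi : i < roundCount r k n)
    (hf : (Set.ofPred fun n => level r n = k).Finite) : i < hf.toFinset.card := by
  classical
  refine lt_of_lt_of_le hi ?_
  unfold roundCount
  rw [Nat.count_eq_card_filter_range]
  refine Finset.card_le_card fun j hj => ?_
  simpa using (Finset.mem_filter.1 hj).2

theorem level_roundTime {i : ℕ} (hi : i < roundCount r k n) : level r (roundTime r k i) = k :=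
  Nat.nth_mem (p := fun n => level r n = k) i (lt_card_of_lt_roundCount hi)

theorem roundCount_lt {N : ℕ} (hn : level r n = k) (hN : n < N) :
    roundCount r k n < roundCount r k N := by
  classical
  exact Nat.count_strict_mono hn hN

theorem roundTime_injOn {i j : ℕ} (hi : i < roundCount r k n) (hj : j < roundCount r k n)
    (h : roundTime r k i = roundTime r k j) : i = j := by
  classical
  rw [← Nat.count_nth (lt_card_of_lt_roundCount hi),
    ← Nat.count_nth (lt_card_of_lt_roundCount hj)]
  exact congrArg _ h

theorem roundCount_congr (h : ∀ i ≤ n, ∀ j ≤ n, (r i j ↔ r' i j)) :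
    roundCount r k n = roundCount r' k n := by
  classical
  unfold roundCount
  rw [Nat.count_eq_card_filter_range, Nat.count_eq_card_filter_range]
  congr 1
  refine Finset.filter_congr fun i hi => ?_
  have hi := (Finset.mem_range.1 hi).le
  rw [level_congr fun a ha b hb => h a (ha.trans hi) b (hb.trans hi)]

variable [IsPartialOrder ℕ r]

theorem roundPoint_le {i : ℕ} (hi : i < roundCount r k n) (t : Fin k) :
    roundPoint r k i t ≤ roundTime r k i :=
  have h := (levelAntichain_spec (level_roundTime hi)).1
  (h.subset (enum_mem h.card t)).1

theorem isLadder_roundRel (r : ℕ → ℕ → Prop) [IsPartialOrder ℕ r] (k n : ℕ) :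
    IsLadder (roundRel r k) (roundCount r k n) := by
  have hspec := fun i (hi : i < roundCount r k n) => levelAntichain_spec (level_roundTime hi)
  have hka : ∀ i < roundCount r k n,
      IsKAntichain r {i | level r i ≤ k} k (levelAntichain r k (roundTime r k i)) :=
    fun i hi => ⟨fun a ha => ((hspec i hi).1.subset ha).2, (hspec i hi).1.antichain,
      (hspec i hi).1.card⟩
  have hrow : ∀ i < roundCount r k n, ∀ j < roundCount r k n,
      RelBelow r (levelAntichain r k (roundTime r k i)) (levelAntichain r k (roundTime r k j)) →
      RowLE (roundRel r k) i j := fun i hi j hj h =>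
    h.exists_perm (widthLE_level_le r k) (hka i hi) (hka j hj) (enum_injective (hka i hi).card)
      (enum_mem (hka i hi).card) fun b hb => exists_enum_eq (hka j hj).card hb
  have hbelow : ∀ i < roundCount r k n, ∀ j < roundCount r k n, RowLE (roundRel r k) i j →
      RelBelow r (levelAntichain r k (roundTime r k i))
        (levelAntichain r k (roundTime r k j)) := by
    rintro i hi j hj ⟨σ, hσ⟩ a ha
    obtain ⟨t, rfl⟩ := exists_enum_eq (hka i hi).card ha
    exact ⟨_, enum_mem (hka j hj).card (σ t), hσ t⟩
  refine ⟨fun i t => refl_of r _, fun i t j u l v => trans_of r, fun i hi j hj => ?_,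
    fun i hi j hj hij hji => ?_⟩
  · rcases lt_trichotomy (roundTime r k i) (roundTime r k j) with hlt | heq | hlt
    · exact ((hspec j hj).2.2 _ hlt (level_roundTime hi)).symm.imp (hrow i hi j hj)
        (hrow j hj i hi)
    · obtain rfl := roundTime_injOn hi hj heq
      exact .inl ⟨1, fun t => refl_of r _⟩
    · exact ((hspec i hi).2.2 _ hlt (level_roundTime hj)).imp (hrow i hi j hj) (hrow j hj i hi)
  · -- Equal antichains were chosen at the same time, as each contains the latest of its points.
    have h₁ := hbelow i hi j hj hij
    have h₂ := hbelow j hj i hi hji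
    refine roundTime_injOn hi hj (le_antisymm ?_ ?_)
    · exact ((hspec j hj).1.subset
        (h₁.subset_of_antichain (hka i hi).antichain h₂ (hspec i hi).2.1)).1
    · exact ((hspec i hi).1.subset
        (h₂.subset_of_antichain (hka j hj).antichain h₁ (hspec j hj).2.1)).1

theorem roundPoint_congr (h : ∀ i ≤ n, ∀ j ≤ n, (r i j ↔ r' i j)) {i : ℕ}
    (hi : i < roundCount r k (n + 1)) : roundPoint r k i = roundPoint r' k i := by
  have hmono : ∀ {m}, m ≤ n → ∀ i ≤ m, ∀ j ≤ m, (r i j ↔ r' i j) := fun hm i hi j hj =>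
    h i (hi.trans hm) j (hj.trans hm)
  have ht : roundTime r k i ≤ n := Nat.lt_succ_iff.1 (roundTime_lt hi)
  have hlev := level_roundTime hi
  have hcount : roundCount r k (roundTime r k i) = i :=
    roundTime_injOn (roundCount_lt hlev (Nat.lt_succ_iff.2 ht)) hi (roundTime_roundCount hlev)
  have htime : roundTime r' k i = roundTime r k i := by
    conv_lhs => rw [← hcount, roundCount_congr (hmono ht)]
    exact roundTime_roundCount ((level_congr (hmono ht)).symm.trans hlev)
  rw [roundPoint, roundPoint, htime, levelAntichain_congr (hmono ht)]

/-- The regular poset presented to the algorithm for level `k` grows on-line. -/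
theorem regLE_roundRel_congr (h : ∀ i ≤ n, ∀ j ≤ n, (r i j ↔ r' i j)) {i j : ℕ} {t u : Fin k}
    (hi : i < roundCount r k (n + 1)) (hj : j < roundCount r k (n + 1)) :
    RegLE (roundRel r k) i t j u ↔ RegLE (roundRel r' k) i t j u := by
  refine regLE_congr (fun i hi j hj t u => ?_) hi hj
  unfold roundRel
  rw [← roundPoint_congr h hi, ← roundPoint_congr h hj]
  exact h _ ((roundPoint_le hi t).trans (Nat.lt_succ_iff.1 (roundTime_lt hi))) _
    ((roundPoint_le hj u).trans (Nat.lt_succ_iff.1 (roundTime_lt hj)))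

end Rounds

/-! ### The level-wise algorithm -/

section Combine

variable {k : ℕ} {q : ℕ → Fin k → ℕ → Fin k → Prop} {m : ℕ} {r r' : ℕ → ℕ → Prop} {n N : ℕ}

/-- The regular poset formed by the rows of a ladder. -/
def IsLadder.regularPoset (h : IsLadder q m) (hk : 0 < k) (hm : 0 < m) : RegularPoset k where
  poset := .of (LadderPoint h)
  rounds := m
  antichain := h.row
  regular := h.isRegular hk hm

def IsLadder.naming (h : IsLadder q m) (hk : 0 < k) (hm : 0 < m) :
    (h.regularPoset hk hm).Naming where
  point := Equiv.refl _
  mem _ _ := h.pt_mem_row.2 rfl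

open Classical in
/-- The colour that the algorithm `A` for regular posets gives to the copy of the point `n` in the
antichain chosen at time `n`. The `else` branch does not occur if `n` has level `k`, the only case
in use. -/
noncomputable def pointColor (A : RegularAlgorithm k) (r : ℕ → ℕ → Prop) (n : ℕ) : ℕ :=
  if h : ∃ t, roundPoint r k (roundCount r k n) t = n then
    A.color (roundCount r k n) (fun a b => RegLE (roundRel r k) a.1 a.2 b.1 b.2) h.choose
  else 0

/-- The colour of a point is determined on-line. -/
theorem pointColor_congr [IsPartialOrder ℕ r] (A : RegularAlgorithm k)
    (h : ∀ i ≤ n, ∀ j ≤ n, (r i j ↔ r' i j)) (hn : level r n = k) :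
    pointColor A r n = pointColor A r' n := by
  have hlt : roundCount r k n < roundCount r k (n + 1) := roundCount_lt hn (Nat.lt_succ_self n)
  have hrel : (fun a b : Fin (roundCount r k n + 1) × Fin k =>
      RegLE (roundRel r k) a.1 a.2 b.1 b.2) =
      fun a b => RegLE (roundRel r' k) a.1 a.2 b.1 b.2 := by
    funext a b
    exact propext (regLE_roundRel_congr h (lt_of_le_of_lt (Nat.lt_succ_iff.1 a.1.isLt) hlt)
      (lt_of_le_of_lt (Nat.lt_succ_iff.1 b.1.isLt) hlt))
  unfold pointColor
  rw [← roundCount_congr h, ← roundPoint_congr h hlt, hrel]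

theorem exists_pointColor_eq [IsPartialOrder ℕ r] (A : RegularAlgorithm k) (hk : 0 < k)
    (hm : 0 < roundCount r k N) (hn : level r n = k) (hN : n < N) :
    ∃ x : Fin (roundCount r k N) × Fin k, roundPoint r k x.1 x.2 = n ∧
      pointColor A r n =
        roundColoring A.color ((isLadder_roundRel r k N).naming hk hm).point x := by
  have hex : ∃ t, roundPoint r k (roundCount r k n) t = n := by
    obtain ⟨hA, hnA, -⟩ := levelAntichain_spec hn
    rw [roundPoint, roundTime_roundCount hn]
    exact exists_enum_eq hA.card hnA
  refine ⟨(⟨roundCount r k n, roundCount_lt hn hN⟩, hex.choose), hex.choose_spec, ?_⟩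
  rw [pointColor, dif_pos hex]
  rfl

/-- The order of the regular poset is contained in the original one, so the colour classes of a
level are chains of the original poset. -/
theorem rel_of_pointColor_eq [IsPartialOrder ℕ r] (A : RegularAlgorithm k) {i j : ℕ}
    (hi : level r i = k) (hj : level r j = k) (hij : pointColor A r i = pointColor A r j) :
    r i j ∨ r j i := by
  have hk : 0 < k := hi ▸ level_pos r i
  obtain ⟨N, hiN, hjN⟩ : ∃ N, i < N ∧ j < N := ⟨max i j + 1, by omega, by omega⟩
  have hm : 0 < roundCount r k N := (Nat.zero_le _).trans_lt (roundCount_lt hi hiN)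
  have hL := isLadder_roundRel r k N
  obtain ⟨x, hx, hxc⟩ := exists_pointColor_eq A hk hm hi hiN
  obtain ⟨y, hy, hyc⟩ := exists_pointColor_eq A hk hm hj hjN
  rw [hxc, hyc] at hij
  rw [← hx, ← hy]
  exact (A.chain _ (hL.naming hk hm) x y hij).imp hL.of_regLE hL.of_regLE

/-- If no point has level `k`, there is no regular poset to consider, and no colour is used. -/
theorem encard_pointColor_le [IsPartialOrder ℕ r] (A : RegularAlgorithm k) (N : ℕ) :
    {c | ∃ n < N, level r n = k ∧ pointColor A r n = c}.encard ≤ ⨆ R, A.chi R := by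
  rcases Set.eq_empty_or_nonempty {c | ∃ n < N, level r n = k ∧ pointColor A r n = c} with he | he
  · simp [he]
  obtain ⟨-, n, hnN, hn, -⟩ := he
  have hk : 0 < k := hn ▸ level_pos r n
  have hm : 0 < roundCount r k N := (Nat.zero_le _).trans_lt (roundCount_lt hn hnN)
  have hL := isLadder_roundRel r k N
  refine le_trans (Set.encard_le_encard ?_) ((le_iSup (fun v : (hL.regularPoset hk hm).Naming =>
    (Set.range (roundColoring A.color v.point)).encard) (hL.naming hk hm)).trans
    (le_iSup A.chi (hL.regularPoset hk hm)))
  rintro c ⟨n, hnN, hn, rfl⟩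
  obtain ⟨x, -, hx⟩ := exists_pointColor_eq A hk hm hn hnN
  exact ⟨x, hx.symm⟩

/-- The extension of a relation on `{0, …, N - 1}` to all natural numbers by isolated points. -/
def extendRel (ρ : Fin N → Fin N → Prop) (a b : ℕ) : Prop :=
  a = b ∨ ∃ (ha : a < N) (hb : b < N), ρ ⟨a, ha⟩ ⟨b, hb⟩

/-- The order of a presented poset, on the times of presentation. -/
def presentedRel {V : Type} [PartialOrder V] (v : Fin N → V) : ℕ → ℕ → Prop :=
  extendRel fun a b => v a ≤ v b

theorem presentedRel_coe {V : Type} [PartialOrder V] {v : Fin N → V} {i j : Fin N} :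
    presentedRel v i j ↔ v i ≤ v j := by
  constructor
  · rintro (h | ⟨_, _, h⟩)
    · rw [Fin.ext h]
    · exact h
  · exact fun h => .inr ⟨i.isLt, j.isLt, h⟩

theorem isPartialOrder_presentedRel {V : Type} [PartialOrder V] {v : Fin N → V}
    (hv : v.Injective) : IsPartialOrder ℕ (presentedRel v) where
  refl a := .inl rfl
  trans := by
    rintro a b c (rfl | ⟨ha, hb, hab⟩) (rfl | ⟨hb', hc, hbc⟩)
    · exact .inl rfl
    · exact .inr ⟨hb', hc, hbc⟩
    · exact .inr ⟨ha, hb, hab⟩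
    · exact .inr ⟨ha, hc, hab.trans hbc⟩
  antisymm := by
    rintro a b (rfl | ⟨ha, hb, hab⟩) (h | ⟨_, _, hba⟩)
    · rfl
    · rfl
    · exact h.symm
    · exact Fin.val_eq_of_eq (hv (le_antisymm hab hba))

/-- The colour of a point consists of its level and of the colour given to it by the algorithm for
regular posets of that width. -/
noncomputable def levelwiseColor (𝒜 : ∀ k, RegularAlgorithm k) (i : ℕ)
    (ρ : Fin (i + 1) → Fin (i + 1) → Prop) : ℕ :=
  Nat.pair (level (extendRel ρ) i) (pointColor (𝒜 (level (extendRel ρ) i)) (extendRel ρ) i)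

theorem onlineColoring_levelwiseColor (𝒜 : ∀ k, RegularAlgorithm k) {V : Type} [PartialOrder V]
    {v : Fin N → V} (hv : v.Injective) (i : Fin N) :
    onlineColoring (levelwiseColor 𝒜) v i = Nat.pair (level (presentedRel v) i)
      (pointColor (𝒜 (level (presentedRel v) i)) (presentedRel v) i) := by
  have := isPartialOrder_presentedRel hv
  have h : ∀ a ≤ (i : ℕ), ∀ b ≤ (i : ℕ), (presentedRel v a b ↔ extendRel
      (fun a b : Fin (i + 1) => v (Fin.castLE i.isLt a) ≤ v (Fin.castLE i.isLt b)) a b) := by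
    intro a ha b hb
    refine or_congr_right ⟨?_, ?_⟩
    · rintro ⟨_, _, h⟩
      exact ⟨Nat.lt_succ_iff.2 ha, Nat.lt_succ_iff.2 hb, h⟩
    · rintro ⟨_, _, h⟩
      exact ⟨ha.trans_lt i.isLt, hb.trans_lt i.isLt, h⟩
  rw [onlineColoring, levelwiseColor, ← level_congr h, ← pointColor_congr _ h rfl]

/-- The on-line algorithm that runs the algorithm `𝒜 k` on the points of level `k`. -/
noncomputable def levelwiseAlgorithm (𝒜 : ∀ k, RegularAlgorithm k) : Algorithm where
  color := levelwiseColor 𝒜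
  chain P N v i j hij := by
    have := isPartialOrder_presentedRel v.injective
    rw [onlineColoring_levelwiseColor 𝒜 v.injective, onlineColoring_levelwiseColor 𝒜 v.injective,
      Nat.pair_eq_pair] at hij
    obtain ⟨hl, hc⟩ := hij
    rw [← hl] at hc
    exact (rel_of_pointColor_eq _ rfl hl.symm hc).imp presentedRel_coe.1 presentedRel_coe.1

theorem level_presentedRel_le {V : Type} [PartialOrder V] [Fintype V] (v : Fin N ≃ V)
    (i : Fin N) : level (presentedRel v) i ≤ width (Finset.univ : Finset V) := by
  classical
  refine level_le_of_widthLE fun T hT ha => ?_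
  let T' : Finset V := Finset.univ.filter fun p => (v.symm p : ℕ) ∈ T
  have hTT' : T ⊆ T'.image fun p => (v.symm p : ℕ) := by
    intro a haT
    have haN : a < N := lt_of_le_of_lt (hT haT) i.isLt
    exact Finset.mem_image.2 ⟨v ⟨a, haN⟩, by simpa [T'] using haT, by simp⟩
  refine ((Finset.card_le_card hTT').trans Finset.card_image_le).trans
    (card_le_width (Finset.subset_univ T') fun p hp p' hp' hne hle => ?_)
  simp only [T', Finset.coe_filter, Finset.mem_univ, true_and, Set.mem_ofPred_eq] at hp hp'
  refine hne (v.symm.injective (Fin.ext (ha.eq hp hp' (presentedRel_coe.2 ?_))))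
  simpa using hle

theorem chiOn_levelwiseAlgorithm_le (𝒜 : ∀ k, RegularAlgorithm k) {P : FinPartOrd.{0}}
    (v : Fin N ≃ P) : (levelwiseAlgorithm 𝒜).chiOn v ≤
      ∑ k ∈ Finset.Icc 1 (width (Finset.univ : Finset P)), ⨆ R, (𝒜 k).chi R := by
  have := isPartialOrder_presentedRel v.injective
  set r := presentedRel v with hr
  have hsub : Set.range (onlineColoring (levelwiseColor 𝒜) v) ⊆
      ⋃ k ∈ Finset.Icc 1 (width (Finset.univ : Finset P)),
        Nat.pair k '' {c | ∃ n < N, level r n = k ∧ pointColor (𝒜 k) r n = c} := by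
    rintro _ ⟨i, rfl⟩
    rw [onlineColoring_levelwiseColor 𝒜 v.injective, ← hr]
    refine Set.mem_biUnion (x := level r i) ?_ ⟨_, ⟨i, i.isLt, rfl, rfl⟩, rfl⟩
    exact Finset.mem_coe.2 (Finset.mem_Icc.2 ⟨level_pos r i, level_presentedRel_le v i⟩)
  refine (Set.encard_le_encard hsub).trans ((Finset.set_encard_biUnion_le _ _).trans
    (Finset.sum_le_sum fun k _ => (Set.encard_image_le _ _).trans (encard_pointColor_le _ _)))

/-- Giving all points different colours is an algorithm, so the infimum defining `valRegular` is
attained. -/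
instance (k : ℕ) : Nonempty (RegularAlgorithm k) :=
  ⟨{ color := fun i _ t => Nat.pair i t
     chain := fun R v x y hxy => by
      simp only [roundColoring, Nat.pair_eq_pair, Fin.val_inj] at hxy
      rw [Prod.ext hxy.1 hxy.2]
      exact .inl le_rfl }⟩

end Combine

end OnlineChain

theorem mainTheorem5 (w : ℕ) :
    OnlineChain.val (OnlineChain.posetsOfWidth w) ≤
      ∑ i ∈ Finset.Icc 1 w, OnlineChain.valRegular i := by
  choose 𝒜 h𝒜 using fun k => ciInf_mem fun A : OnlineChain.RegularAlgorithm k => ⨆ R, A.chi R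
  refine iInf_le_of_le (OnlineChain.levelwiseAlgorithm 𝒜) (iSup₂_le fun P hP => ?_)
  refine iSup₂_le fun n v => (OnlineChain.chiOn_levelwiseAlgorithm_le 𝒜 v).trans ?_
  rw [show OnlineChain.width (Finset.univ : Finset P) = w from hP]
  exact (Finset.sum_congr rfl fun k _ => h𝒜 k).le
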